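/- Let $K$ be an algebraically closed field of characteristic zero, let $\mathbb{P}^1=\mathrm{Proj}\,K[x_0,x_1]$ be the projective line over $K$, and let $\mathcal{O}(d)$, $d\in\mathbb{Z}$, be Serre's twisting sheaves on it. Let $\mathrm{K}(\mathbb{P}^1)$ be the Grothendieck group of locally free sheaves of finite rank on $\mathbb{P}^1$, i.e. the abelian group generated by symbols $[\mathcal{E}]$, one for each such sheaf $\mathcal{E}$, with relations $[\mathcal{E}]=[\mathcal{E}']+[\mathcal{E}'']$ for every short exact sequence $0\to\mathcal{E}'\to\mathcal{E}\to\mathcal{E}''\to 0$ of locally free sheaves of finite rank. For $\mathcal{E}\cong\mathcal{O}(d_1)\oplus\cdots\oplus\mathcal{O}(d_e)$ put $\deg(\mathcal{E})=d_1+\cdots+d_e$. Then every sheaf $\mathcal{O}(d_1)\oplus\cdots\oplus\mathcal{O}(d_e)$ ($e\ge 0$, $d_i\in\mathbb{Z}$) is locally free of rank $e$, and there is a unique isomorphism of abelian groups $$\phi:\mathrm{K}(\mathbb{P}^1)\xrightarrow{\ \cong\ }\mathbb{Z}\oplus\mathbb{Z}$$ such that $$\phi([\mathcal{E}])=(\deg(\mathcal{E}),\mathrm{rk}(\mathcal{E}))$$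 for every locally free sheaf $\mathcal{E}$ isomorphic to some $\mathcal{O}(d_1)\oplus\cdots\oplus\mathcal{O}(d_e)$, where $\mathrm{rk}(\mathcal{E})$ is the rank of $\mathcal{E}$, and such that the second component of $\phi([\mathcal{E}])$ is $\mathrm{rk}(\mathcal{E})$ for every locally free sheaf $\mathcal{E}$ of constant finite rank $\mathrm{rk}(\mathcal{E})$. -/

import Mathlib

universe u

open CategoryTheory Limits AlgebraicGeometry TopologicalSpace Opposite

noncomputable section

namespace KTheoryP1

/-! ### Vector bundles on a scheme and their Grothendieck group -/

/-- The `𝒪_X`-module `M` is free of rank `r` on some open neighbourhood of the point `x`. -/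
def HasRankAt {X : Scheme.{u}} (M : X.Modules) (x : X) (r : ℕ) : Prop :=
  ∃ U : X.Opens, x ∈ U ∧
    Nonempty (M.restrict U.ι ≅
      (SheafOfModules.free (R := (U : Scheme.{u}).ringCatSheaf) (ULift.{u} (Fin r)) :
        (U : Scheme.{u}).Modules))

/-- `M` is a locally free sheaf of finite rank: near every point it is free of some finite rank. -/
def IsLocallyFreeFiniteRank {X : Scheme.{u}} (M : X.Modules) : Prop :=
  ∀ x : X, ∃ r : ℕ, HasRankAt M x r

/-- `M` is a locally free sheaf of constant rank `r`. -/
def HasRank {X : Scheme.{u}} (M : X.Modules) (r : ℕ) : Prop :=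
  ∀ x : X, HasRankAt M x r

/-- The locally free sheaves of finite rank on `X`. -/
structure VectorBundle (X : Scheme.{u}) where
  /-- the underlying sheaf of modules -/
  sheaf : X.Modules
  isLocallyFree : IsLocallyFreeFiniteRank sheaf

/-- The subgroup of the free abelian group on the vector bundles that is generated by the elements
`[E] - [E'] - [E'']`, one for each short exact sequence `0 ⟶ E' ⟶ E ⟶ E'' ⟶ 0`. -/
def exactRelations (X : Scheme.{u}) : AddSubgroup (FreeAbelianGroup (VectorBundle X)) :=
  AddSubgroup.closure
    {z | ∃ (E' E E'' : VectorBundle X) (i : E'.sheaf ⟶ E.sheaf) (p : E.sheaf ⟶ E''.sheaf)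
        (w : i ≫ p = 0), (ShortComplex.mk i p w).ShortExact ∧
        z = FreeAbelianGroup.of E - FreeAbelianGroup.of E' - FreeAbelianGroup.of E''}

/-- The Grothendieck group `K(X)` of locally free sheaves of finite rank on `X`. -/
abbrev KGroup (X : Scheme.{u}) : Type (u + 1) :=
  FreeAbelianGroup (VectorBundle X) ⧸ exactRelations X

/-- The class `[E]` in `K(X)`. -/
def KGroup.of {X : Scheme.{u}} (E : VectorBundle X) : KGroup X :=
  QuotientAddGroup.mk (FreeAbelianGroup.of E)

/-! ### The twisting sheaves on `Proj` -/

section Twist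

variable {A σ : Type u} [CommRing A] [SetLike σ A] [AddSubgroupClass σ A]
variable (𝒜 : ℕ → σ) [GradedRing 𝒜] (d : ℤ)

/-- The elements of `A` outside the homogeneous prime `x`. -/
abbrev complAt (x : ProjectiveSpectrum 𝒜) : Submonoid A :=
  x.asHomogeneousIdeal.toIdeal.primeCompl

/-- The localization of the graded ring `A` at the homogeneous prime `x` (every element outside `x`
is inverted). -/
abbrev LocAt (x : ProjectiveSpectrum 𝒜) : Type u :=
  Localization (complAt 𝒜 x)

/-- On all of `U` the function `f` is one fraction `a / b` with `a`, `b` homogeneous and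
`deg a - deg b = d`. -/
def IsTwistFraction {U : Opens (ProjectiveSpectrum.top 𝒜)} (f : ∀ x : U, LocAt 𝒜 x.1) : Prop :=
  ∃ (i j : ℕ) (a : 𝒜 i) (b : 𝒜 j), (i : ℤ) - j = d ∧
    ∀ x : U, ∃ hb : (b : A) ∈ complAt 𝒜 x.1, f x = Localization.mk (a : A) ⟨b, hb⟩

/-- `IsTwistFraction` passes to smaller open sets. -/
def twistPrelocal : TopCat.PrelocalPredicate (X := ProjectiveSpectrum.top 𝒜) (LocAt 𝒜) where
  pred f := IsTwistFraction 𝒜 d f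
  res := by
    rintro V U i f ⟨m, n, a, b, h, w⟩
    exact ⟨m, n, a, b, h, fun x => w (i x)⟩

/-- Functions that locally are fractions of degree `d`. -/
def twistLocal : TopCat.LocalPredicate (X := ProjectiveSpectrum.top 𝒜) (LocAt 𝒜) :=
  (twistPrelocal 𝒜 d).sheafify

theorem exists_homogeneous_mem_complAt (x : ProjectiveSpectrum 𝒜) :
    ∃ (i j : ℕ) (b : 𝒜 j), (i : ℤ) - j = d ∧ (b : A) ∈ complAt 𝒜 x := by
  obtain ⟨n, hn, c, hc, hcx⟩ : ∃ n : ℕ, 0 < n ∧ ∃ c ∈ 𝒜 n, c ∈ complAt 𝒜 x := by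
    by_contra! H
    refine x.not_irrelevant_le fun r hr => ?_
    classical
    rw [← DirectSum.sum_support_decompose 𝒜 r]
    refine sum_mem fun k _ => ?_
    rcases Nat.eq_zero_or_pos k with rfl | hk
    · have h0 : ((DirectSum.decompose 𝒜 r 0 : 𝒜 0) : A) = 0 := by
        simpa [HomogeneousIdeal.mem_irrelevant_iff, GradedRing.proj_apply] using hr
      rw [h0]
      exact zero_mem _
    · by_contra hx
      exact H k hk _ (SetLike.coe_mem _) hx
  refine ⟨(((n * d.natAbs : ℕ) : ℤ) + d).toNat, d.natAbs * n,
    ⟨c ^ d.natAbs, SetLike.pow_mem_graded _ hc⟩, ?_, pow_mem hcx _⟩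
  have h1 : d.natAbs ≤ n * d.natAbs := Nat.le_mul_of_pos_left _ hn
  rw [mul_comm d.natAbs n]
  omega

theorem twist_zero_mem (U : Opens (ProjectiveSpectrum.top 𝒜)) :
    (twistLocal 𝒜 d).pred (fun x : U => (0 : LocAt 𝒜 x.1)) := by
  intro x
  obtain ⟨i, j, b, h, hb⟩ := exists_homogeneous_mem_complAt 𝒜 d x.1
  refine ⟨U ⊓ ProjectiveSpectrum.basicOpen 𝒜 (b : A), ⟨x.2, hb⟩, homOfLE inf_le_left,
    i, j, 0, b, h, fun y => ⟨y.2.2, ?_⟩⟩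
  simp [Localization.mk_zero]

theorem twist_add_mem (U : Opens (ProjectiveSpectrum.top 𝒜)) (f g : ∀ x : U, LocAt 𝒜 x.1)
    (hf : (twistLocal 𝒜 d).pred f) (hg : (twistLocal 𝒜 d).pred g) :
    (twistLocal 𝒜 d).pred (fun x => f x + g x) := by
  intro x
  obtain ⟨V, hxV, iV, m, n, a, b, h, w⟩ := hf x
  obtain ⟨V', hxV', iV', m', n', a', b', h', w'⟩ := hg x
  refine ⟨V ⊓ V', ⟨hxV, hxV'⟩, homOfLE inf_le_left ≫ iV, m + n', n + n',
    ⟨(b' : A) * a + b * a', add_mem ?_ ?_⟩, ⟨(b : A) * b', SetLike.mul_mem_graded b.2 b'.2⟩,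
    by push_cast; omega, fun y => ?_⟩
  · rw [add_comm m n']
    exact SetLike.mul_mem_graded b'.2 a.2
  · rw [show m + n' = n + m' by omega]
    exact SetLike.mul_mem_graded b.2 a'.2
  · obtain ⟨hb, e⟩ := w ⟨y.1, y.2.1⟩
    obtain ⟨hb', e'⟩ := w' ⟨y.1, y.2.2⟩
    refine ⟨mul_mem hb hb', (congrArg₂ (· + ·) e e').trans ?_⟩
    simp only [Localization.add_mk]
    congr 1
    simp [add_comm]

theorem twist_neg_mem (U : Opens (ProjectiveSpectrum.top 𝒜)) (f : ∀ x : U, LocAt 𝒜 x.1)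
    (hf : (twistLocal 𝒜 d).pred f) : (twistLocal 𝒜 d).pred (fun x => -f x) := by
  intro x
  obtain ⟨V, hxV, iV, m, n, a, b, h, w⟩ := hf x
  refine ⟨V, hxV, iV, m, n, -a, b, h, fun y => ?_⟩
  obtain ⟨hb, e⟩ := w y
  exact ⟨hb, (congrArg (- ·) e).trans (by simp [Localization.neg_mk])⟩

/-- Pointwise multiplication by a section of the structure sheaf preserves degree `d`. -/
theorem twist_smul_mem (U : Opens (ProjectiveSpectrum.top 𝒜))
    (s : (ProjectiveSpectrum.Proj.structureSheaf 𝒜).1.obj (op U)) (f : ∀ x : U, LocAt 𝒜 x.1)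
    (hf : (twistLocal 𝒜 d).pred f) :
    (twistLocal 𝒜 d).pred (fun x => (s.1 x).val * f x) := by
  intro x
  obtain ⟨V, hxV, iV, n, a, b, hb, w⟩ := s.2 x
  obtain ⟨V', hxV', iV', m', n', a', b', h', w'⟩ := hf x
  refine ⟨V ⊓ V', ⟨hxV, hxV'⟩, homOfLE inf_le_left ≫ iV, n + m', n + n',
    ⟨(a : A) * a', SetLike.mul_mem_graded a.2 a'.2⟩,
    ⟨(b : A) * b', SetLike.mul_mem_graded b.2 b'.2⟩, by push_cast; omega, fun y => ?_⟩
  have e := w ⟨y.1, y.2.1⟩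
  obtain ⟨hb', e'⟩ := w' ⟨y.1, y.2.2⟩
  refine ⟨mul_mem (hb ⟨y.1, y.2.1⟩) hb',
    (congrArg₂ (· * ·) (congrArg HomogeneousLocalization.val e) e').trans ?_⟩
  rw [HomogeneousLocalization.val_mk, Localization.mk_mul]
  rfl

/-- The sections of `𝒪(d)` over `U`: the functions sending `x ∈ U` to an element of the
localization of `A` at `x` which locally are fractions of degree `d`. -/
def twistSections (U : Opens (ProjectiveSpectrum.top 𝒜)) :
    AddSubgroup (∀ x : U, LocAt 𝒜 x.1) where
  carrier := {f | (twistLocal 𝒜 d).pred f}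
  zero_mem' := twist_zero_mem 𝒜 d U
  add_mem' := twist_add_mem 𝒜 d U _ _
  neg_mem' := twist_neg_mem 𝒜 d U _

/-- The sections of `𝒪(d)` over `U` form a module over the sections of the structure sheaf. -/
instance twistModule (U : (Opens (ProjectiveSpectrum.top 𝒜))ᵒᵖ) :
    Module ((ProjectiveSpectrum.Proj.structureSheaf 𝒜).1.obj U) (twistSections 𝒜 d U.unop) where
  smul s f := ⟨fun x => (s.1 x).val * f.1 x, twist_smul_mem 𝒜 d U.unop s f.1 f.2⟩
  one_smul f := Subtype.ext <| funext fun x =>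
    (congrArg (· * f.1 x) HomogeneousLocalization.val_one).trans (one_mul _)
  mul_smul _ _ f := Subtype.ext <| funext fun x =>
    (congrArg (· * f.1 x) (HomogeneousLocalization.val_mul _ _)).trans (mul_assoc _ _ _)
  smul_zero _ := Subtype.ext <| funext fun _ => mul_zero _
  smul_add _ _ _ := Subtype.ext <| funext fun _ => mul_add _ _ _
  add_smul _ _ f := Subtype.ext <| funext fun x =>
    (congrArg (· * f.1 x) (HomogeneousLocalization.val_add _ _)).trans (add_mul _ _ _)
  zero_smul f := Subtype.ext <| funext fun x =>
    (congrArg (· * f.1 x) HomogeneousLocalization.val_zero).trans (zero_mul _)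

/-- The presheaf of abelian groups underlying `𝒪(d)`, with the restriction of functions. -/
def twistPresheafAb : TopCat.Presheaf Ab.{u} (ProjectiveSpectrum.top 𝒜) where
  obj U := AddCommGrpCat.of (twistSections 𝒜 d U.unop)
  map i := AddCommGrpCat.ofHom
    { toFun := (TopCat.subsheafToTypes (twistLocal 𝒜 d)).1.map i
      map_zero' := rfl
      map_add' _ _ := rfl }

/-- The presheaf of modules underlying `𝒪(d)`. -/
def twistPresheaf : (Proj 𝒜).PresheafOfModules :=
  letI (U : (Opens (Proj 𝒜))ᵒᵖ) :
    Module ((Proj 𝒜).ringCatSheaf.obj.obj U) ((twistPresheafAb 𝒜 d).obj U) :=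
    twistModule 𝒜 d U
  PresheafOfModules.ofPresheaf (R := (Proj 𝒜).ringCatSheaf.obj) (twistPresheafAb 𝒜 d)
    fun _ _ _ _ _ => rfl

/-- Serre's twisting sheaf `𝒪(d)` on `Proj A`: the sheaf associated with the graded module `A(d)`.
-/
def twist : (Proj 𝒜).Modules where
  val := twistPresheaf 𝒜 d
  isSheaf := (TopCat.Presheaf.isSheaf_iff_isSheaf_comp (forget AddCommGrpCat) _).2
    (TopCat.subsheafToTypes (twistLocal 𝒜 d)).2

end Twist

/-! ### The projective line -/

attribute [local instance] MvPolynomial.gradedAlgebra Abelian.hasFiniteBiproducts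

/-- The projective line over `K`, with homogeneous coordinate ring `K[x₀, x₁]`. -/
abbrev P1 (K : Type u) [Field K] : Scheme.{u} :=
  Proj (MvPolynomial.homogeneousSubmodule (Fin 2) K)

/-- The line bundle `𝒪(d)` on the projective line. -/
abbrev O (K : Type u) [Field K] (d : ℤ) : (P1 K).Modules :=
  twist (MvPolynomial.homogeneousSubmodule (Fin 2) K) d

/-- The split bundle `𝒪(d₁) ⊕ ⋯ ⊕ 𝒪(dₑ)` on the projective line. -/
abbrev splitBundle (K : Type u) [Field K] {e : ℕ} (d : Fin e → ℤ) : (P1 K).Modules :=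
  ⨁ fun i => O K (d i)

/-- `E` has degree `δ`: it is isomorphic to a split bundle `𝒪(d₁) ⊕ ⋯ ⊕ 𝒪(dₑ)` with
`d₁ + ⋯ + dₑ = δ`. -/
def HasDegree {K : Type u} [Field K] (E : (P1 K).Modules) (δ : ℤ) : Prop :=
  ∃ (e : ℕ) (d : Fin e → ℤ), Nonempty (E ≅ splitBundle K d) ∧ ∑ i, d i = δ

end KTheoryP1

end

/-!
On each of the two standard charts of the projective line a vector bundle has a global frame,
because the coordinate ring is a principal ideal domain. The determinant of the transition matrix
between the two frames is a unit of `K[T;T⁻¹]`, that is `c * T ^ δ`, and the units on the charts are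
constants; so `δ` is an invariant of the bundle. It is additive in short exact sequences, whose
transition matrices are block triangular, and equals the degree on split bundles.

Clearing denominators in one frame vector and dividing out its content gives frames whose first
members span a subbundle `𝒪(d)` with locally free quotient, so the `[𝒪(d)]` generate the
Grothendieck group. As `𝒪(d + 1)²` contains both `𝒪(d)` and `𝒪(d + 1)` with line bundles as
quotients, `[𝒪(d)] + [𝒪(d + 2)] = 2 [𝒪(d + 1)]`. Hence `[𝒪(0)]` and `[𝒪(1)]` generate, and degree
and rank form an isomorphism.
-/

noncomputable section

namespace KTheoryP1

attribute [local instance] Abelian.hasFiniteBiproducts MvPolynomial.gradedAlgebra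

/-! ### Sections of sheaves of modules -/

section Sections

variable {X : Scheme.{u}} {M N : X.Modules} {U V W : X.Opens}

/-- Restriction of sections of a sheaf of modules to a smaller open set. -/
def res (M : X.Modules) {U V : X.Opens} (h : V ≤ U) : Γ(M, U) →+ Γ(M, V) :=
  (M.presheaf.map (homOfLE h).op).hom

/-- Restriction of functions to a smaller open set. -/
def resFun {X : Scheme.{u}} {U V : X.Opens} (h : V ≤ U) : Γ(X, U) →+* Γ(X, V) :=
  (X.presheaf.map (homOfLE h).op).hom

theorem res_res (h : V ≤ U) (h' : W ≤ V) (s : Γ(M, U)) :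
    res M h' (res M h s) = res M (h'.trans h) s := by
  simp only [res]
  rw [← homOfLE_comp h' h, op_comp, Functor.map_comp]
  rfl

@[simp]
theorem res_self (h : U ≤ U) (s : Γ(M, U)) : res M h s = s := by
  simp [res]

@[simp]
theorem resFun_self (h : U ≤ U) (r : Γ(X, U)) : resFun h r = r := by
  simp [resFun]

theorem resFun_resFun (h : V ≤ U) (h' : W ≤ V) (r : Γ(X, U)) :
    resFun h' (resFun h r) = resFun (h'.trans h) r := by
  simp only [resFun]
  rw [← homOfLE_comp h' h, op_comp, Functor.map_comp]
  rfl

theorem res_smul (h : V ≤ U) (r : Γ(X, U)) (s : Γ(M, U)) :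
    res M h (r • s) = resFun h r • res M h s :=
  M.map_smul (homOfLE h) r s

theorem res_sum_smul {ι : Type*} (t : Finset ι) (h : V ≤ U) (a : ι → Γ(X, U)) (s : ι → Γ(M, U)) :
    res M h (∑ i ∈ t, a i • s i) = ∑ i ∈ t, resFun h (a i) • res M h (s i) := by
  simp only [map_sum, res_smul]

theorem app_res (φ : M ⟶ N) (h : V ≤ U) (s : Γ(M, U)) :
    φ.app V (res M h s) = res N h (φ.app U s) :=
  congr($(φ.mapPresheaf.naturality (homOfLE h).op) s)

/-- A morphism of sheaves of modules on sections over `U`, as a linear map. -/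
def appLinear (φ : M ⟶ N) (U : X.Opens) : Γ(M, U) →ₗ[Γ(X, U)] Γ(N, U) where
  __ := (φ.app U).hom
  map_smul' := φ.app_smul

theorem app_sum_smul {ι : Type*} [Fintype ι] (φ : M ⟶ N) (a : ι → Γ(X, U)) (s : ι → Γ(M, U)) :
    φ.app U (∑ i, a i • s i) = ∑ i, a i • φ.app U (s i) := by
  simp only [map_sum, Scheme.Modules.Hom.app_smul]

theorem app_bijective (φ : M ⟶ N) [IsIso φ] (U : X.Opens) : Function.Bijective (φ.app U) :=
  (ConcreteCategory.isIso_iff_bijective _).1 inferInstance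

/-- An isomorphism of sheaves of modules on sections over `U`, as a linear equivalence. -/
def appLinearEquiv (e : M ≅ N) (U : X.Opens) : Γ(M, U) ≃ₗ[Γ(X, U)] Γ(N, U) :=
  .ofBijective (appLinear e.hom U) (app_bijective e.hom U)

theorem eq_of_res_eq {s t : Γ(M, U)}
    (h : ∀ x ∈ U, ∃ (V : X.Opens) (hV : V ≤ U), x ∈ V ∧ res M hV s = res M hV t) : s = t := by
  choose V hV hx e using h
  exact TopCat.Sheaf.eq_of_locally_eq' ⟨M.presheaf, M.isSheaf⟩ (fun x : U => V x.1 x.2) U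
    (fun x => homOfLE (hV _ _)) (fun x hxU => Opens.mem_iSup.2 ⟨⟨x, hxU⟩, hx x hxU⟩) s t
    fun x => e _ _

theorem eq_of_resFun_eq {r r' : Γ(X, U)}
    (h : ∀ x ∈ U, ∃ (V : X.Opens) (hV : V ≤ U), x ∈ V ∧ resFun hV r = resFun hV r') : r = r' := by
  choose V hV hx e using h
  exact TopCat.Sheaf.eq_of_locally_eq' X.sheaf (fun x : U => V x.1 x.2) U
    (fun x => homOfLE (hV _ _)) (fun x hxU => Opens.mem_iSup.2 ⟨⟨x, hxU⟩, hx x hxU⟩) r r'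
    fun x => e _ _

theorem exists_res_eq {κ : Type*} (V : κ → X.Opens) (hV : ∀ k, V k ≤ U) (hc : U ≤ iSup V)
    (s : ∀ k, Γ(M, V k))
    (hs : ∀ k l, res M (inf_le_left : V k ⊓ V l ≤ V k) (s k) =
      res M (inf_le_right : V k ⊓ V l ≤ V l) (s l)) :
    ∃ t : Γ(M, U), ∀ k, res M (hV k) t = s k :=
  (TopCat.Sheaf.existsUnique_gluing' ⟨M.presheaf, M.isSheaf⟩ V U
    (fun k => homOfLE (hV k)) hc s hs).exists

theorem exists_resFun_eq {κ : Type*} (V : κ → X.Opens) (hV : ∀ k, V k ≤ U) (hc : U ≤ iSup V)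
    (r : ∀ k, Γ(X, V k))
    (hr : ∀ k l, resFun (inf_le_left : V k ⊓ V l ≤ V k) (r k) =
      resFun (inf_le_right : V k ⊓ V l ≤ V l) (r l)) :
    ∃ t : Γ(X, U), ∀ k, resFun (hV k) t = r k :=
  (TopCat.Sheaf.existsUnique_gluing' X.sheaf V U (fun k => homOfLE (hV k)) hc r hr).exists

theorem eq_of_res_eq_pair (h : W ≤ U ⊔ V) {s t : Γ(M, W)}
    (hU : res M (inf_le_left : W ⊓ U ≤ W) s = res M inf_le_left t)
    (hV : res M (inf_le_left : W ⊓ V ≤ W) s = res M inf_le_left t) : s = t := by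
  refine eq_of_res_eq fun x hx => ?_
  rcases h hx with h | h
  · exact ⟨_, inf_le_left, ⟨hx, h⟩, hU⟩
  · exact ⟨_, inf_le_left, ⟨hx, h⟩, hV⟩

theorem exists_res_eq_pair (h : W ≤ U ⊔ V) (s : Γ(M, W ⊓ U)) (t : Γ(M, W ⊓ V))
    (e : ∀ (A : X.Opens) (h₁ : A ≤ W ⊓ U) (h₂ : A ≤ W ⊓ V), res M h₁ s = res M h₂ t) :
    ∃ r : Γ(M, W), res M inf_le_left r = s ∧ res M inf_le_left r = t := by
  obtain ⟨r, hr⟩ := exists_res_eq (M := M) (U := W)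
    (fun k : Bool => match k with
      | true => W ⊓ U
      | false => W ⊓ V)
    (by rintro (_ | _) <;> exact inf_le_left)
    (fun x hx => (h hx).elim (fun h => Opens.mem_iSup.2 ⟨true, hx, h⟩)
      fun h => Opens.mem_iSup.2 ⟨false, hx, h⟩)
    (fun k => match k with
      | true => s
      | false => t)
    (by
      rintro (_ | _) (_ | _)
      exacts [rfl, (e _ inf_le_right inf_le_left).symm, e _ inf_le_left inf_le_right, rfl])
  exact ⟨r, hr true, hr false⟩

/-- The morphism of sheaves of modules with prescribed values on sections. -/
def homOfSections (f : ∀ U, Γ(M, U) →ₗ[Γ(X, U)] Γ(N, U))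
    (hf : ∀ (U V : X.Opens) (h : V ≤ U) (s : Γ(M, U)), f V (res M h s) = res N h (f U s)) :
    M ⟶ N :=
  ⟨fun U => ModuleCat.ofHom (f U.unop), fun i => by ext s; exact hf _ _ i.unop.le s⟩

theorem mono_of_injective (φ : M ⟶ N) (h : ∀ U, Function.Injective (φ.app U)) : Mono φ := by
  refine ⟨fun α β e => ?_⟩
  ext U s
  exact h U congr(($e).app U s)

theorem mono_of_injective_of_sup_eq_top (hUV : U ⊔ V = ⊤) {φ : N ⟶ M}
    (hU : ∀ W ≤ U, Function.Injective (φ.app W)) (hV : ∀ W ≤ V, Function.Injective (φ.app W)) :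
    Mono φ :=
  mono_of_injective φ fun W s t hst =>
    eq_of_res_eq_pair (hUV ▸ le_top : W ≤ U ⊔ V)
      (hU _ inf_le_right (by rw [app_res, app_res, hst]))
      (hV _ inf_le_right (by rw [app_res, app_res, hst]))

theorem isIso_of_bijective (φ : M ⟶ N) (h : ∀ U, Function.Bijective (φ.app U)) : IsIso φ := by
  rw [Scheme.Modules.Hom.isIso_iff_isIso_app]
  exact fun U => (ConcreteCategory.isIso_iff_bijective _).2 (h U)

theorem app_injective (φ : M ⟶ N) [Mono φ] (U : X.Opens) : Function.Injective (φ.app U) := by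
  have : Mono ((Scheme.Modules.toPresheaf X).map φ) := inferInstance
  have h : Mono (((Scheme.Modules.toPresheaf X).map φ).app (op U)) := inferInstance
  exact (AddCommGrpCat.mono_iff_injective _).1 h

theorem exists_app_eq_of_exact {S : ShortComplex X.Modules} (hS : S.Exact) [Mono S.f]
    (s : Γ(S.X₂, U)) (h : S.g.app U s = 0) : ∃ t : Γ(S.X₁, U), S.f.app U t = s := by
  let F : X.Modules ⥤ Ab := Scheme.Modules.toPresheaf X ⋙ (evaluation X.Opensᵒᵖ Ab.{u}).obj (op U)
  have : F.PreservesZeroMorphisms := ⟨fun _ _ => rfl⟩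
  have : PreservesLimitsOfSize.{0, 0} (Scheme.Modules.toPresheaf X) :=
    preservesLimitsOfSize_shrink _
  have : PreservesLimitsOfShape WalkingParallelPair
    ((evaluation X.Opensᵒᵖ Ab.{u}).obj (op U)) := evaluation_preservesLimitsOfShape _
  have : PreservesLimitsOfShape WalkingParallelPair F := comp_preservesLimitsOfShape _ _
  have := hS.map_of_mono_of_preservesKernel F inferInstance inferInstance
  exact (ShortComplex.ab_exact_iff _).1 this s h

variable {J : Type} (F : J → X.Modules)

theorem biproduct_π_app_ι_app [Finite J] [DecidableEq J] (j k : J) (s : Γ(F j, U)) :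
    (biproduct.π F k).app U ((biproduct.ι F j).app U s) =
      Pi.single (M := fun j => Γ(F j, U)) j s k := by
  rw [← ConcreteCategory.comp_apply, ← Scheme.Modules.Hom.comp_app]
  obtain rfl | hjk := eq_or_ne j k
  · rw [biproduct.ι_π_self, Pi.single_eq_same]
    rfl
  · rw [biproduct.ι_π_ne _ hjk, Pi.single_eq_of_ne hjk.symm]
    rfl

variable [Fintype J]

theorem sum_biproduct_ι_app_π_app (s : Γ(⨁ F, U)) :
    ∑ j, (biproduct.ι F j).app U ((biproduct.π F j).app U s) = s := by
  let ev : ((⨁ F) ⟶ (⨁ F)) →+ Γ(⨁ F, U) :=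
    { toFun := fun φ => φ.app U s, map_zero' := rfl, map_add' := fun _ _ => rfl }
  have := congrArg ev (biproduct.total (f := F))
  rwa [map_sum] at this

/-- The sections of a finite direct sum are the families of sections of the summands. -/
def biproductSectionsEquiv (U : X.Opens) : Γ(⨁ F, U) ≃ₗ[Γ(X, U)] ∀ j, Γ(F j, U) where
  __ := LinearMap.pi fun j => appLinear (biproduct.π F j) U
  invFun s := ∑ j, (biproduct.ι F j).app U (s j)
  left_inv s := sum_biproduct_ι_app_π_app F s
  right_inv s := by
    classical
    ext k
    change (biproduct.π F k).app U (∑ j, (biproduct.ι F j).app U (s j)) = s k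
    simp only [map_sum, biproduct_π_app_ι_app, Finset.sum_pi_single, Finset.mem_univ, if_true]

theorem biproductSectionsEquiv_symm_single [DecidableEq J] (j : J) (s : Γ(F j, U)) :
    (biproductSectionsEquiv F U).symm (Pi.single j s) = (biproduct.ι F j).app U s := by
  change ∑ k, (biproduct.ι F k).app U (Pi.single (M := fun j => Γ(F j, U)) j s k) = _
  rw [Finset.sum_eq_single j, Pi.single_eq_same]
  · intro k _ hk
    rw [Pi.single_eq_of_ne hk, map_zero]
  · exact fun h => absurd (Finset.mem_univ j) h

end Sections

/-! ### Frames -/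

section Frames

theorem exists_basis_iff_bijective {R M ι : Type*} [Semiring R] [AddCommMonoid M] [Module R M]
    [Fintype ι] (v : ι → M) :
    (∃ B : Module.Basis ι R M, ∀ i, B i = v i) ↔
      Function.Bijective fun a : ι → R => ∑ i, a i • v i := by
  classical
  constructor
  · rintro ⟨B, hB⟩
    convert B.equivFun.symm.bijective using 2 with a
    simp only [← hB, Module.Basis.equivFun_symm_apply]
  · intro h
    refine ⟨.ofEquivFun (LinearEquiv.ofBijective (Fintype.linearCombination R v) h).symm,
      fun i => ?_⟩
    rw [Module.Basis.coe_ofEquivFun]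
    exact (Fintype.linearCombination_apply_single R v i 1).trans (one_smul R _)

theorem injective_of_linearIndependent_basis {R M N ι : Type*} [Semiring R] [AddCommMonoid M]
    [AddCommMonoid N] [Module R M] [Module R N] {f : M →ₗ[R] N} (b : Module.Basis ι R M)
    (h : LinearIndependent R (f ∘ b)) : Function.Injective f := by
  convert h.finsuppLinearCombination_injective.comp b.repr.injective using 1
  funext s
  rw [Function.comp_apply, ← Finsupp.apply_linearCombination, b.linearCombination_repr]

theorem exists_basis_smul_eq {R M ι : Type*} [CommRing R] [IsDomain R] [IsPrincipalIdealRing R]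
    [AddCommGroup M] [Module R M] [Finite ι] (b : Module.Basis ι R M) (i : ι) {w : M}
    (hw : w ≠ 0) : ∃ (c : Module.Basis ι R M) (r : R), w = r • c i := by
  classical
  obtain ⟨m, c, bN, f, a, h⟩ := (Submodule.span R {w}).smithNormalForm b
  have := Module.Free.of_basis b
  obtain rfl : m = 1 := by
    simpa using Fintype.card_congr (bN.indexEquiv ((Module.Basis.singleton Unit R).map
      (LinearEquiv.toSpanNonzeroSingleton R M w hw)))
  have hsum := congrArg Subtype.val (bN.sum_repr ⟨w, Submodule.mem_span_singleton_self w⟩)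
  simp only [Finset.univ_unique, Finset.sum_singleton, Submodule.coe_smul, h, smul_smul] at hsum
  exact ⟨c.reindex (Equiv.swap (f default) i), _, by simpa using hsum.symm⟩

variable {X : Scheme.{u}} {M N : X.Modules} {U V W : X.Opens} {ι κ τ : Type*}

/-- A frame of `M` on `U`: sections over `U` whose restrictions form a basis of the module of
sections over every open subset of `U`. -/
def IsFrame (M : X.Modules) (U : X.Opens) (b : ι → Γ(M, U)) : Prop :=
  ∀ (W : X.Opens) (h : W ≤ U), ∃ B : Module.Basis ι Γ(X, W) Γ(M, W), ∀ i, B i = res M h (b i)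

/-- The basis of the sections over `W ≤ U` given by a frame on `U`. -/
def IsFrame.basis {b : ι → Γ(M, U)} (hb : IsFrame M U b) (h : W ≤ U) :
    Module.Basis ι Γ(X, W) Γ(M, W) :=
  (hb W h).choose

@[simp]
theorem IsFrame.basis_apply {b : ι → Γ(M, U)} (hb : IsFrame M U b) (h : W ≤ U) (i : ι) :
    hb.basis h i = res M h (b i) :=
  (hb W h).choose_spec i

theorem isFrame_iff_bijective [Fintype ι] {b : ι → Γ(M, U)} :
    IsFrame M U b ↔ ∀ (W : X.Opens) (h : W ≤ U),
      Function.Bijective fun a : ι → Γ(X, W) => ∑ i, a i • res M h (b i) :=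
  forall₂_congr fun _ _ => exists_basis_iff_bijective _

theorem IsFrame.bijective [Fintype ι] {b : ι → Γ(M, U)} (hb : IsFrame M U b) :
    Function.Bijective fun a : ι → Γ(X, U) => ∑ i, a i • b i :=
  (exists_basis_iff_bijective b).1 ⟨hb.basis le_rfl, fun i => by simp⟩

theorem IsFrame.restrict {b : ι → Γ(M, U)} (hb : IsFrame M U b) (h : V ≤ U) :
    IsFrame M V fun i => res M h (b i) :=
  fun _ hW => ⟨hb.basis (hW.trans h), fun i => by rw [hb.basis_apply, res_res]⟩

theorem IsFrame.reindex {b : ι → Γ(M, U)} (hb : IsFrame M U b) (e : κ ≃ ι) :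
    IsFrame M U fun k => b (e k) :=
  fun _ hW => ⟨(hb.basis hW).reindex e.symm, fun k => by simp⟩

theorem IsFrame.map_iso {b : ι → Γ(M, U)} (hb : IsFrame M U b) (e : M ≅ N) :
    IsFrame N U fun i => e.hom.app U (b i) :=
  fun W hW => ⟨(hb.basis hW).map (appLinearEquiv e W), fun i => by
    rw [Module.Basis.map_apply, hb.basis_apply]
    exact app_res e.hom hW (b i)⟩

theorem IsFrame.smul {b : ι → Γ(M, U)} (hb : IsFrame M U b) {u : ι → Γ(X, U)}
    (hu : ∀ i, IsUnit (u i)) : IsFrame M U fun i => u i • b i :=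
  fun _ hW => ⟨(hb.basis hW).isUnitSMul fun i => (hu i).map (resFun hW), fun i => by
    rw [Module.Basis.isUnitSMul_apply, hb.basis_apply, res_smul]⟩

theorem IsFrame.isUnit_of_eq_smul {b : ι → Γ(M, U)} (hb : IsFrame M U b) {i : ι} {r : Γ(X, U)}
    {s : Γ(M, U)} (h : b i = r • s) : IsUnit r := by
  classical
  have hi : hb.basis le_rfl i = r • s := by rwa [hb.basis_apply, res_self]
  refine .of_mul_eq_one ((hb.basis le_rfl).repr s i) ?_
  rw [← smul_eq_mul, ← Finsupp.smul_apply, ← map_smul, ← hi, Module.Basis.repr_self_apply,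
    if_pos rfl]

theorem IsFrame.sumElim_zero_succ {n : ℕ} {b : Fin (n + 1) → Γ(M, U)} (hb : IsFrame M U b) :
    IsFrame M U (Sum.elim (fun _ : Unit => b 0) fun i : Fin n => b i.succ) := by
  convert hb.reindex ((Equiv.sumComm _ _).trans ((Equiv.optionEquivSumPUnit.{0} (Fin n)).symm.trans
    (finSuccEquiv n).symm)) with i
  rcases i with i | i <;> simp

theorem IsFrame.app_injective {φ : N ⟶ M} {e : ι → Γ(N, U)} {c : κ → Γ(M, U)}
    (he : IsFrame N U e) (hc : IsFrame M U (Sum.elim (fun i => φ.app U (e i)) c)) (hW : W ≤ U) :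
    Function.Injective (φ.app W) := by
  have hφe : appLinear φ W ∘ he.basis hW = hc.basis hW ∘ Sum.inl := by
    funext i
    rw [Function.comp_apply, Function.comp_apply, hc.basis_apply, he.basis_apply]
    exact app_res φ hW (e i)
  exact injective_of_linearIndependent_basis (f := appLinear φ W) (he.basis hW)
    (hφe ▸ (hc.basis hW).linearIndependent.comp Sum.inl Sum.inl_injective)

theorem IsFrame.card_eq [Fintype ι] [Fintype κ] {b : ι → Γ(M, U)} {c : κ → Γ(M, U)}
    (hb : IsFrame M U b) (hc : IsFrame M U c) {x : X} (hx : x ∈ U) :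
    Fintype.card ι = Fintype.card κ := by
  have : Nonempty U := ⟨⟨x, hx⟩⟩
  exact Fintype.card_congr ((hb.basis le_rfl).indexEquiv (hc.basis le_rfl))

theorem injective_sum_smul_res_of_nhds [Fintype ι] (h : W ≤ U) {b : ι → Γ(M, U)}
    (H : ∀ x ∈ W, ∃ (V : X.Opens) (hV : V ≤ W), x ∈ V ∧
      Function.Injective fun a : ι → Γ(X, V) => ∑ i, a i • res M (hV.trans h) (b i)) :
    Function.Injective fun a : ι → Γ(X, W) => ∑ i, a i • res M h (b i) := by
  intro a a' e
  funext i
  refine eq_of_resFun_eq fun x hx => ?_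
  obtain ⟨V, hV, hxV, hinj⟩ := H x hx
  refine ⟨V, hV, hxV, congrFun (hinj (a₁ := fun i => resFun hV (a i))
    (a₂ := fun i => resFun hV (a' i)) ?_) i⟩
  simpa only [res_sum_smul, res_res] using congrArg (res M hV) e

theorem isFrame_of_nhds_bijective [Fintype ι] {b : ι → Γ(M, U)}
    (H : ∀ W ≤ U, ∀ x ∈ W, ∃ (V : X.Opens) (h : V ≤ U), V ≤ W ∧ x ∈ V ∧
      Function.Bijective fun a : ι → Γ(X, V) => ∑ i, a i • res M h (b i)) : IsFrame M U b := by
  have inj (W : X.Opens) (h : W ≤ U) :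
      Function.Injective fun a : ι → Γ(X, W) => ∑ i, a i • res M h (b i) :=
    injective_sum_smul_res_of_nhds h fun x hx =>
      let ⟨V, _, hVW, hxV, hbij⟩ := H W h x hx
      ⟨V, hVW, hxV, hbij.1⟩
  refine isFrame_iff_bijective.2 fun W h => ⟨inj W h, fun s => ?_⟩
  choose V hVU hVW hxV hbij using H W h
  choose a ha using fun x : W => (hbij x.1 x.2).2 (res M (hVW x.1 x.2) s)
  have compatible (x y : W) :
      (fun i => resFun (inf_le_left : V x.1 x.2 ⊓ V y.1 y.2 ≤ _) (a x i)) =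
        fun i => resFun (inf_le_right : V x.1 x.2 ⊓ V y.1 y.2 ≤ _) (a y i) := by
    apply inj _ (inf_le_left.trans (hVU x.1 x.2))
    have hx := congrArg (res M (inf_le_left : V x.1 x.2 ⊓ V y.1 y.2 ≤ _)) (ha x)
    have hy := congrArg (res M (inf_le_right : V x.1 x.2 ⊓ V y.1 y.2 ≤ _)) (ha y)
    simp only [res_sum_smul, res_res] at hx hy
    exact hx.trans hy.symm
  choose t ht using fun i => exists_resFun_eq (fun x : W => V x.1 x.2) (fun x => hVW x.1 x.2)
    (fun x hx => Opens.mem_iSup.2 ⟨⟨x, hx⟩, hxV x hx⟩) (fun x => a x i)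
    fun x y => congrFun (compatible x y) i
  refine ⟨t, eq_of_res_eq fun x hx => ⟨_, hVW x hx, hxV x hx, ?_⟩⟩
  simp only [res_sum_smul, res_res, ht _ ⟨x, hx⟩]
  exact ha ⟨x, hx⟩

theorem isFrame_biproduct {J : Type} [Finite J] {σ : J → Type*} [∀ j, Finite (σ j)]
    (F : J → X.Modules) {b : ∀ j, σ j → Γ(F j, U)} (hb : ∀ j, IsFrame (F j) U (b j)) :
    IsFrame (⨁ F) U fun k : Σ j, σ j => (biproduct.ι F k.1).app U (b k.1 k.2) := by
  classical
  have := Fintype.ofFinite J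
  refine fun W h =>
    ⟨(Pi.basis fun j => (hb j).basis h).map (biproductSectionsEquiv F W).symm, fun k => ?_⟩
  rw [Module.Basis.map_apply, Pi.basis_apply, biproductSectionsEquiv_symm_single,
    IsFrame.basis_apply, app_res]

section Transition

/-- `c = b A` for families of sections `b`, `c` and a matrix of functions `A`. -/
def IsTransition [Fintype ι] (b : ι → Γ(M, U)) (c : κ → Γ(M, U)) (A : Matrix ι κ Γ(X, U)) : Prop :=
  ∀ k, c k = ∑ i, A i k • b i

variable [Fintype ι] {b : ι → Γ(M, U)} {c : κ → Γ(M, U)} {A : Matrix ι κ Γ(X, U)}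

theorem IsFrame.exists_transition (hb : IsFrame M U b) (c : κ → Γ(M, U)) :
    ∃ A, IsTransition b c A :=
  ⟨(hb.basis le_rfl).toMatrix c, fun k => by
    simpa using ((hb.basis le_rfl).sum_toMatrix_smul_self c k).symm⟩

theorem IsTransition.unique (hb : IsFrame M U b) {B : Matrix ι κ Γ(X, U)}
    (hA : IsTransition b c A) (hB : IsTransition b c B) : A = B := by
  ext i k
  exact congrFun (hb.bijective.1 (a₁ := fun i => A i k) (a₂ := fun i => B i k)
    ((hA k).symm.trans (hB k))) i

theorem IsTransition.refl [DecidableEq ι] (b : ι → Γ(M, U)) : IsTransition b b 1 := by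
  intro k
  simp [Matrix.one_apply]

theorem IsTransition.mul [Fintype κ] {d : τ → Γ(M, U)} {B : Matrix κ τ Γ(X, U)}
    (hA : IsTransition b c A) (hB : IsTransition c d B) : IsTransition b d (A * B) := by
  intro t
  simp_rw [hB t, hA _, Finset.smul_sum, smul_smul, Matrix.mul_apply, Finset.sum_smul]
  rw [Finset.sum_comm]
  simp_rw [mul_comm]

theorem IsTransition.restrict (hA : IsTransition b c A) (h : V ≤ U) :
    IsTransition (fun i => res M h (b i)) (fun k => res M h (c k)) (A.map (resFun h)) := by
  intro k
  simp only [hA k, res_sum_smul, Matrix.map_apply]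

theorem IsTransition.map (hA : IsTransition b c A) (φ : M ⟶ N) :
    IsTransition (fun i => φ.app U (b i)) (fun k => φ.app U (c k)) A := by
  intro k
  simpa only [app_sum_smul] using congrArg (φ.app U) (hA k)

theorem IsFrame.isUnit_det [DecidableEq ι] {c : ι → Γ(M, U)} {A : Matrix ι ι Γ(X, U)}
    (hb : IsFrame M U b) (hc : IsFrame M U c) (hA : IsTransition b c A) : IsUnit A.det := by
  obtain ⟨B, hB⟩ := hc.exists_transition b
  have hAB : A * B = 1 := (hA.mul hB).unique hb (.refl b)
  exact .of_mul_eq_one B.det (by rw [← Matrix.det_mul, hAB, Matrix.det_one])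

theorem IsFrame.of_isUnit_det [DecidableEq ι] {c : ι → Γ(M, U)}
    {A : Matrix ι ι Γ(X, U)} (hb : IsFrame M U b) (hA : IsTransition b c A) (hu : IsUnit A.det) :
    IsFrame M U c := by
  intro W h
  have hdet : (hb.basis h).det (fun k => res M h (c k)) = resFun h A.det := by
    rw [RingHom.map_det, RingHom.mapMatrix_apply, Module.Basis.det_apply]
    congr 1
    refine IsTransition.unique (hb.restrict h) (fun k => ?_) (hA.restrict h)
    simpa using ((hb.basis h).sum_toMatrix_smul_self (fun k => res M h (c k)) k).symm
  have hW := (hb.basis h).is_basis_iff_det.2 (hdet ▸ hu.map (resFun h))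
  exact ⟨.mk hW.1 hW.2.ge, fun i => by simp⟩

end Transition

theorem IsFrame.of_basis [Finite ι] {b : ι → Γ(M, U)} (hb : IsFrame M U b)
    (c : Module.Basis ι Γ(X, U) Γ(M, U)) : IsFrame M U c := by
  classical
  have := Fintype.ofFinite ι
  refine hb.of_isUnit_det (A := (hb.basis le_rfl).toMatrix c) (fun k => ?_) ?_
  · simpa using ((hb.basis le_rfl).sum_toMatrix_smul_self c k).symm
  · exact (hb.basis le_rfl).isUnit_det c

end Frames

section LocalHoms

variable {X : Scheme.{u}} {M N : X.Modules} {U V : X.Opens} {ι κ : Type*}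

/-- A morphism from `N` to `M` defined over the open set `U` only: linear maps on sections over the
open subsets of `U`, compatible with restriction. -/
structure LocalHom (N M : X.Modules) (U : X.Opens) where
  app : ∀ W ≤ U, Γ(N, W) →ₗ[Γ(X, W)] Γ(M, W)
  app_res : ∀ {W W' : X.Opens} (h : W ≤ U) (h' : W' ≤ W) (s : Γ(N, W)),
    app W' (h'.trans h) (res N h' s) = res M h' (app W h s)

/-- The morphism over `U` sending the frame `e` of `N` to the sections `v` of `M`. -/
def IsFrame.lift {e : ι → Γ(N, U)} (he : IsFrame N U e) (v : ι → Γ(M, U)) :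
    LocalHom N M U where
  app W h := (he.basis h).constr Γ(X, W) fun i => res M h (v i)
  app_res {W W'} h h' s := by
    obtain ⟨a, rfl⟩ : ∃ a : ι →₀ Γ(X, W), ∑ i ∈ a.support, a i • he.basis h i = s :=
      ⟨_, (he.basis h).linearCombination_repr s⟩
    have hres (i : ι) : res N h' (he.basis h i) = he.basis (h'.trans h) i := by
      rw [he.basis_apply, he.basis_apply, res_res]
    simp only [map_sum, map_smul, res_smul, hres, Module.Basis.constr_basis, res_res]

theorem IsFrame.lift_app {e : ι → Γ(N, U)} (he : IsFrame N U e) (v : ι → Γ(M, U))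
    {W : X.Opens} (h : W ≤ U) (i : ι) : (he.lift v).app W h (res N h (e i)) = res M h (v i) := by
  rw [← he.basis_apply]
  exact (he.basis h).constr_basis _ _ i

theorem exists_hom_of_localHom_pair (hc : U ⊔ V = ⊤) (α : LocalHom N M U) (β : LocalHom N M V)
    (H : ∀ W (h : W ≤ U) (h' : W ≤ V), α.app W h = β.app W h') :
    ∃ φ : N ⟶ M, (∀ s, φ.app U s = α.app U le_rfl s) ∧ ∀ s, φ.app V s = β.app V le_rfl s := by
  have hW (W : X.Opens) : W ≤ U ⊔ V := hc ▸ le_top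
  choose f hU hV using fun (W : X.Opens) (s : Γ(N, W)) =>
    exists_res_eq_pair (hW W) (α.app _ inf_le_right (res N inf_le_left s))
      (β.app _ inf_le_right (res N inf_le_left s)) fun A h₁ h₂ => by
        rw [← α.app_res, ← β.app_res, res_res, res_res, H]
  have hα {W W' : X.Opens} (h : W' ≤ W) (h' : W' ≤ U) (s : Γ(N, W)) :
      res M h (f W s) = α.app W' h' (res N h s) := by
    have := congrArg (res M (le_inf h h')) (hU W s)
    rwa [res_res, ← α.app_res, res_res] at this
  have hβ {W W' : X.Opens} (h : W' ≤ W) (h' : W' ≤ V) (s : Γ(N, W)) :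
      res M h (f W s) = β.app W' h' (res N h s) := by
    have := congrArg (res M (le_inf h h')) (hV W s)
    rwa [res_res, ← β.app_res, res_res] at this
  have hf {W : X.Opens} {s : Γ(N, W)} {t : Γ(M, W)}
      (hα' : res M inf_le_left t = α.app (W ⊓ U) inf_le_right (res N inf_le_left s))
      (hβ' : res M inf_le_left t = β.app (W ⊓ V) inf_le_right (res N inf_le_left s)) :
      f W s = t :=
    eq_of_res_eq_pair (hW W) ((hU W s).trans hα'.symm) ((hV W s).trans hβ'.symm)
  let φ : N ⟶ M := homOfSections
    (fun W =>
      { toFun := f W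
        map_add' s t := hf (by simp only [map_add, hU]) (by simp only [map_add, hV])
        map_smul' r s := hf (by simp only [res_smul, map_smul, hU, RingHom.id_apply])
          (by simp only [res_smul, map_smul, hV, RingHom.id_apply]) })
    fun W W' h s => hf
      ((res_res h _ _).trans <| by rw [res_res]; exact hα (inf_le_left.trans h) inf_le_right s)
      ((res_res h _ _).trans <| by rw [res_res]; exact hβ (inf_le_left.trans h) inf_le_right s)
  refine ⟨φ, fun s => ?_, fun s => ?_⟩
  · exact (res_self le_rfl (f U s)).symm.trans ((hα le_rfl le_rfl s).trans (by rw [res_self]))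
  · exact (res_self le_rfl (f V s)).symm.trans ((hβ le_rfl le_rfl s).trans (by rw [res_self]))

theorem exists_hom_of_frames [Fintype κ] (hc : U ⊔ V = ⊤)
    {e : ι → Γ(N, U)} {e' : κ → Γ(N, V)} (he : IsFrame N U e) (he' : IsFrame N V e')
    (v : ι → Γ(M, U)) (v' : κ → Γ(M, V)) {g : Matrix κ ι Γ(X, U ⊓ V)}
    (hg : IsTransition (fun k => res N inf_le_right (e' k)) (fun i => res N inf_le_left (e i)) g)
    (hv : IsTransition (fun k => res M inf_le_right (v' k)) (fun i => res M inf_le_left (v i)) g) :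
    ∃ φ : N ⟶ M, (∀ i, φ.app U (e i) = v i) ∧ ∀ k, φ.app V (e' k) = v' k := by
  obtain ⟨φ, hU, hV⟩ := exists_hom_of_localHom_pair hc (he.lift v) (he'.lift v') fun W h h' => by
    refine (he.basis h).ext fun i => ?_
    have hgW := hg.restrict (le_inf h h') i
    have hvW := hv.restrict (le_inf h h') i
    simp only [res_res] at hgW hvW
    rw [he.basis_apply, he.lift_app, hgW, hvW]
    simp only [map_sum, map_smul, he'.lift_app]
  refine ⟨φ, fun i => ?_, fun k => ?_⟩
  · simpa only [res_self] using (hU (e i)).trans (by simpa using he.lift_app v le_rfl i)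
  · simpa only [res_self] using (hV (e' k)).trans (by simpa using he'.lift_app v' le_rfl k)

theorem IsFrame.app_bijective {φ : N ⟶ M} {e : ι → Γ(N, U)} (he : IsFrame N U e)
    (h : IsFrame M U fun i => φ.app U (e i)) (hV : V ≤ U) : Function.Bijective (φ.app V) := by
  have hφ : ((he.basis hV).equiv (h.basis hV) (Equiv.refl ι)).toLinearMap = appLinear φ V := by
    refine (he.basis hV).ext fun i => ?_
    rw [LinearEquiv.coe_coe, Module.Basis.equiv_apply, IsFrame.basis_apply, IsFrame.basis_apply]
    exact (app_res φ hV (e i)).symm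
  exact congrArg DFunLike.coe hφ ▸ LinearEquiv.bijective _

theorem nonempty_iso_of_frames {e : ι → Γ(N, ⊤)} {v : ι → Γ(M, ⊤)} (he : IsFrame N ⊤ e)
    (hv : IsFrame M ⊤ v) : Nonempty (N ≅ M) := by
  obtain ⟨φ, h, -⟩ := exists_hom_of_localHom_pair (top_sup_eq ⊤) (he.lift v) (he.lift v)
    fun _ _ _ => rfl
  obtain rfl : (fun i => φ.app ⊤ (e i)) = v := funext fun i => by
    simpa only [res_self] using (h (e i)).trans (by simpa using he.lift_app v le_rfl i)
  have := isIso_of_bijective φ fun V => he.app_bijective hv le_top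
  exact ⟨asIso φ⟩

end LocalHoms

/-! ### Frames and local freeness -/

section LocallyFree

variable {X Y : Scheme.{u}} {M : X.Modules}

/-- The structure sheaf as a module over itself. -/
def unitModule (X : Scheme.{u}) : X.Modules := SheafOfModules.unit X.ringCatSheaf

theorem isFrame_unitModule (X : Scheme.{u}) :
    IsFrame (unitModule X) ⊤ fun _ : Unit => (1 : Γ(X, ⊤)) :=
  fun W h => ⟨Module.Basis.singleton Unit Γ(X, W), fun i =>
    (Module.Basis.singleton_apply Unit Γ(X, W) i).trans (map_one (resFun h)).symm⟩

theorem exists_isFrame_free (X : Scheme.{u}) (r : ℕ) :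
    ∃ e : Fin r → Γ((SheafOfModules.free (R := X.ringCatSheaf) (ULift.{u} (Fin r)) :
      X.Modules), ⊤), IsFrame _ ⊤ e := by
  let F : Fin r → X.Modules := fun _ => unitModule X
  let i : (⨁ F) ≅ (SheafOfModules.free (R := X.ringCatSheaf) (ULift.{u} (Fin r)) : X.Modules) :=
    biproduct.isoCoproduct F ≪≫
      Sigma.whiskerEquiv (f := F) (g := fun _ : ULift.{u} (Fin r) => unitModule X)
        Equiv.ulift.symm fun _ => Iso.refl _
  exact ⟨_, ((isFrame_biproduct F fun _ => isFrame_unitModule X).map_iso i).reindex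
    (Equiv.sigmaPUnit (Fin r)).symm⟩

theorem isFrame_restrict_iff {ι : Type*} [Finite ι] (j : Y ⟶ X) [IsOpenImmersion j]
    {V : Y.Opens} (b : ι → Γ(M, j ''ᵁ V)) :
    IsFrame (M.restrict j) V b ↔ IsFrame M (j ''ᵁ V) b := by
  have := Fintype.ofFinite ι
  have bijective_iff (W : Y.Opens) (h : W ≤ V) :
      (Function.Bijective fun a : ι → Γ(Y, W) => ∑ i, a i • res (M.restrict j) h (b i)) ↔
        Function.Bijective fun a : ι → Γ(X, j ''ᵁ W) =>
          ∑ i, a i • res M (j.image_mono h) (b i) := by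
    have hj : Function.Bijective (j.appIso W).inv :=
      (ConcreteCategory.isIso_iff_bijective _).1 inferInstance
    rw [← Function.Bijective.of_comp_iff _ (Function.Bijective.piMap fun _ : ι => hj)]
    rfl
  refine isFrame_iff_bijective.trans (.trans ⟨?_, ?_⟩ isFrame_iff_bijective.symm)
  · intro H W h
    obtain ⟨W, rfl⟩ : ∃ W' : Y.Opens, j ''ᵁ W' = W := by
      refine ⟨j ⁻¹ᵁ W, ?_⟩
      rw [Scheme.Hom.image_preimage_eq_opensRange_inf]
      exact inf_eq_right.2 (h.trans (j.image_le_opensRange V))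
    have hWV : W ≤ V := (j.image_le_image_iff W V).1 h
    exact (bijective_iff W hWV).1 (H W hWV)
  · exact fun H W h => (bijective_iff W h).2 (H _ (j.image_mono h))

theorem hasRankAt_iff {x : X} {r : ℕ} :
    HasRankAt M x r ↔ ∃ U : X.Opens, x ∈ U ∧ ∃ b : Fin r → Γ(M, U), IsFrame M U b := by
  constructor
  · rintro ⟨U, hx, ⟨e⟩⟩
    obtain ⟨b, hb⟩ := exists_isFrame_free (U : Scheme.{u}) r
    have := (isFrame_restrict_iff U.ι _).1 (hb.map_iso e.symm)
    exact ⟨U, hx, _, this.restrict (by simp)⟩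
  · rintro ⟨U, hx, b, hb⟩
    obtain ⟨e, he⟩ := exists_isFrame_free (U : Scheme.{u}) r
    have hb' := (isFrame_restrict_iff U.ι (V := ⊤) _).2
      (hb.restrict (show U.ι ''ᵁ ⊤ ≤ U by simp))
    exact ⟨U, hx, nonempty_iso_of_frames hb' he⟩

theorem HasRank.isLocallyFreeFiniteRank {r : ℕ} (h : HasRank M r) : IsLocallyFreeFiniteRank M :=
  fun x => ⟨r, h x⟩

end LocallyFree

/-! ### Locally free sheaves on affine open sets -/

section Quasicoherent

/-- The presentation of a free sheaf of modules without relations. -/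
def freePresentation {X : Scheme.{u}} (I : Type u) :
    (SheafOfModules.free (R := X.ringCatSheaf) I).Presentation :=
  SheafOfModules.presentationOfIsCokernelFree
    (0 : SheafOfModules.free (R := X.ringCatSheaf) PEmpty.{u + 1} ⟶ _) (𝟙 _) (by simp)
    (CokernelCofork.IsColimit.ofId _ rfl)

theorem IsLocallyFreeFiniteRank.isQuasicoherent {X : Scheme.{u}} {M : X.Modules}
    (h : IsLocallyFreeFiniteRank M) : M.IsQuasicoherent := by
  choose r U hx e using h
  have covers : (Opens.grothendieckTopology X).CoversTop U := by
    rw [Opens.coversTop_iff]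
    exact eq_top_iff.2 fun x _ => Opens.mem_iSup.2 ⟨x, hx x⟩
  have presentation (x : X) : (SheafOfModules.over M (U x)).Presentation := by
    let F : SheafOfModules.{u} (U x : Scheme.{u}).ringCatSheaf ⥤
      SheafOfModules.{u} (X.ringCatSheaf.over (U x)) := (Scheme.Modules.overEquiv (U x)).inverse
    have η : SheafOfModules.unit _ ≅ F.obj (SheafOfModules.unit _) :=
      (Scheme.Modules.overEquiv (U x)).unitIso.app (SheafOfModules.unit _)
    have i : SheafOfModules.over M (U x) ≅ F.obj (SheafOfModules.free (ULift (Fin (r x)))) :=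
      (Scheme.Modules.overEquiv (U x)).unitIso.app _ ≪≫
        F.mapIso ((Scheme.Modules.overFunctorEquiv (U x)).app M ≪≫ (e x).some)
    have : PreservesColimitsOfSize.{u, u} F :=
      (Scheme.Modules.overEquiv (U x)).symm.toAdjunction.leftAdjoint_preservesColimits
    exact ((freePresentation _).map F η).ofIsIso i.inv
  exact SheafOfModules.QuasicoherentData.isQuasicoherent (M := M)
    { I := X, X := U, coversTop := covers, presentation := presentation }

end Quasicoherent

section Adjunction

variable {C D : Type*} [Category C] [Category D] {F : C ⥤ D} {G : D ⥤ C}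

theorem epi_map_of_essImage (adj : F ⊣ G) [F.Full] [F.Faithful] {M N : D} (hM : F.essImage M)
    (hN : F.essImage N) (φ : M ⟶ N) [Epi φ] : Epi (G.map φ) := by
  have := adj.isIso_counit_app_iff_mem_essImage.2 hM
  have := adj.isIso_counit_app_iff_mem_essImage.2 hN
  have : Epi (F.map (G.map φ) ≫ adj.counit.app N) := by
    rw [show F.map (G.map φ) ≫ adj.counit.app N = adj.counit.app M ≫ φ from
      adj.counit.naturality φ]
    exact epi_comp _ _
  exact F.epi_of_epi_map ((epi_comp_iff_of_isIso _ _).1 this)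

theorem essImage_cokernel (adj : F ⊣ G) [F.Full] [F.Faithful] [HasZeroMorphisms C]
    [HasZeroMorphisms D] [HasCokernels C] [HasCokernels D] {M N : D} (hM : F.essImage M)
    (hN : F.essImage N) (φ : M ⟶ N) : F.essImage (cokernel φ) := by
  have := adj.isIso_counit_app_iff_mem_essImage.2 hM
  have := adj.isIso_counit_app_iff_mem_essImage.2 hN
  have := adj.leftAdjoint_preservesColimits
  have : F.PreservesZeroMorphisms := inferInstance
  exact ⟨cokernel (G.map φ), ⟨PreservesCokernel.iso F (G.map φ) ≪≫
    cokernel.mapIso _ _ (asIso (adj.counit.app M)) (asIso (adj.counit.app N))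
      (adj.counit.naturality φ)⟩⟩

end Adjunction

section Affine

variable {R : CommRingCat.{u}} {M N : (Spec R).Modules}

/-- A sheaf of modules on an affine scheme is associated with a module. -/
abbrev IsTilde (M : (Spec R).Modules) : Prop := (tilde.functor R).essImage M

theorem app_top_surjective_of_epi (φ : M ⟶ N) [Epi φ] (hM : IsTilde M) (hN : IsTilde N) :
    Function.Surjective (φ.app ⊤) := by
  have := epi_map_of_essImage (tilde.adjunction (R := R)) hM hN φ
  exact (ModuleCat.epi_iff_surjective ((moduleSpecΓFunctor (R := R)).map φ)).1 this

theorem IsLocallyFreeFiniteRank.isTilde_restrict {X : Scheme.{u}} {E : X.Modules}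
    (hE : IsLocallyFreeFiniteRank E) (j : Spec R ⟶ X) [IsOpenImmersion j] :
    IsTilde (E.restrict j) := by
  have := hE.isQuasicoherent
  have := Scheme.Modules.isQuasicoherent_restrictFunctor j E
  exact isIso_fromTildeΓ_iff.1 ((isQuasicoherent_iff_isIso_fromTildeΓ (R := R) _).1 this)

theorem isTilde_restrict_cokernel {X : Scheme.{u}} {E F : X.Modules}
    (hE : IsLocallyFreeFiniteRank E) (hF : IsLocallyFreeFiniteRank F) (φ : E ⟶ F)
    (j : Spec R ⟶ X) [IsOpenImmersion j] : IsTilde ((cokernel φ).restrict j) :=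
  (tilde.functor R).essImage.prop_of_iso
    (PreservesCokernel.iso (Scheme.Modules.restrictFunctor j) φ).symm
    (essImage_cokernel (tilde.adjunction (R := R)) (hE.isTilde_restrict j) (hF.isTilde_restrict j)
      ((Scheme.Modules.restrictFunctor j).map φ))

/-- The basic open set `D(f)`, as an open subset of the scheme `Spec R`. -/
def specBasicOpen (f : R) : (Spec R).Opens := PrimeSpectrum.basicOpen f

theorem exists_mem_specBasicOpen_le {U : (Spec R).Opens} {x : Spec R} (hx : x ∈ U) :
    ∃ f : R, x ∈ specBasicOpen f ∧ specBasicOpen f ≤ U := by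
  obtain ⟨_, ⟨_, ⟨f, rfl⟩, rfl⟩, hxf, hf⟩ :=
    PrimeSpectrum.isBasis_basic_opens.exists_subset_of_mem_open hx U.2
  exact ⟨f, hxf, hf⟩

instance isLocalization_specBasicOpen (f : R) :
    IsLocalization.Away f Γ(Spec R, specBasicOpen f) := by
  unfold specBasicOpen
  infer_instance

/-- Restriction of global sections to a basic open set, as a linear map. -/
def resLinear (M : (Spec R).Modules) (f : R) : Γ(M, ⊤) →ₗ[R] Γ(M, specBasicOpen f) where
  __ := res M le_top
  map_smul' r x := M.map_smul_Spec (homOfLE le_top).op r x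

theorem IsTilde.isLocalizedModule (hM : IsTilde M) (f : R) :
    IsLocalizedModule (.powers f) (resLinear M f) :=
  (isIso_fromTildeΓ_iff_isLocalizing (R := R) M).1 (isIso_fromTildeΓ_iff.2 hM) f

theorem isFrame_top_of_basis {ι : Type*} [Finite ι] (hM : IsTilde M)
    (b : Module.Basis ι R Γ(M, ⊤)) : IsFrame M ⊤ b := by
  have := Fintype.ofFinite ι
  refine isFrame_of_nhds_bijective fun W _ x hx => ?_
  obtain ⟨f, hxf, hf⟩ := exists_mem_specBasicOpen_le hx
  have := hM.isLocalizedModule f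
  exact ⟨specBasicOpen f, le_top, hf, hxf, (exists_basis_iff_bijective _).1
    ⟨b.ofIsLocalizedModule Γ(Spec R, specBasicOpen f) (.powers f) (resLinear M f),
      b.ofIsLocalizedModule_apply _ _ _⟩⟩

/-- Every point of `Spec R` has an open neighbourhood on which `M` has a finite frame. -/
def HasLocalFrames (M : (Spec R).Modules) : Prop :=
  ∀ x : Spec R, ∃ U : (Spec R).Opens, x ∈ U ∧ ∃ (r : ℕ) (b : Fin r → Γ(M, U)), IsFrame M U b

theorem exists_isFrame_specBasicOpen (h : HasLocalFrames M) (x : Spec R) :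
    ∃ f : R, x ∈ specBasicOpen f ∧
      ∃ (r : ℕ) (b : Fin r → Γ(M, specBasicOpen f)), IsFrame M (specBasicOpen f) b := by
  obtain ⟨U, hx, r, b, hb⟩ := h x
  obtain ⟨f, hxf, hf⟩ := exists_mem_specBasicOpen_le hx
  exact ⟨f, hxf, r, _, hb.restrict hf⟩

theorem finite_of_hasLocalFrames (hM : IsTilde M) (h : HasLocalFrames M) :
    Module.Finite R Γ(M, ⊤) := by
  choose f hxf r b hb using exists_isFrame_specBasicOpen h
  have hspan : Ideal.span (Set.range f) = ⊤ :=
    PrimeSpectrum.iSup_basicOpen_eq_top_iff.1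
      (eq_top_iff.2 fun x _ => Opens.mem_iSup.2 ⟨x, hxf x⟩)
  have := fun t : Set.range f => hM.isLocalizedModule t.1
  refine Module.Finite.of_localizationSpan' (Set.range f) hspan
    (Rₚ := fun t => Γ(Spec R, specBasicOpen t.1)) (fun t => resLinear M t.1) ?_
  rintro ⟨_, x, rfl⟩
  exact Module.Finite.of_basis ((hb x).basis le_rfl)

theorem isTorsionFree_specBasicOpen [IsDomain R] {f : R} (hf : f ≠ 0) {ι : Type*}
    {b : ι → Γ(M, specBasicOpen f)} (hb : IsFrame M (specBasicOpen f) b) :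
    Module.IsTorsionFree R Γ(M, specBasicOpen f) := by
  have hle := powers_le_nonZeroDivisors_of_noZeroDivisors hf
  have : IsDomain Γ(Spec R, specBasicOpen f) :=
    IsLocalization.isDomain_of_le_nonZeroDivisors _ hle
  have : FaithfulSMul R Γ(Spec R, specBasicOpen f) :=
    (faithfulSMul_iff_algebraMap_injective _ _).2 (IsLocalization.injective _ hle)
  have := (hb.basis le_rfl).isTorsionFree
  exact .trans_faithfulSMul R Γ(Spec R, specBasicOpen f) _

theorem isTorsionFree_of_hasLocalFrames [IsDomain R] (h : HasLocalFrames M) :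
    Module.IsTorsionFree R Γ(M, ⊤) := by
  choose f hxf r b hb using exists_isFrame_specBasicOpen h
  refine .of_smul_eq_zero fun a m ham => or_iff_not_imp_left.2 fun ha =>
    eq_of_res_eq fun x _ => ⟨specBasicOpen (f x), le_top, hxf x, ?_⟩
  have hf : f x ≠ 0 := by
    intro h₀
    have hx : x ∈ PrimeSpectrum.basicOpen (f x) := hxf x
    rw [h₀, PrimeSpectrum.basicOpen_zero] at hx
    exact hx
  have := isTorsionFree_specBasicOpen hf (hb x)
  rw [map_zero, ← smul_eq_zero_iff_right ha]
  exact ((resLinear M (f x)).map_smul a m).symm.trans (by rw [ham, map_zero])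

theorem exists_isFrame_top [IsDomain R] [IsPrincipalIdealRing R] (hM : IsTilde M)
    (h : HasLocalFrames M) : ∃ (n : ℕ) (b : Fin n → Γ(M, ⊤)), IsFrame M ⊤ b := by
  have := finite_of_hasLocalFrames hM h
  have := isTorsionFree_of_hasLocalFrames h
  exact ⟨_, _, isFrame_top_of_basis hM (Module.finBasis R Γ(M, ⊤))⟩

end Affine

section AffineOpen

theorem isFrame_top_of_basis_sections {R : CommRingCat.{u}} {M : (Spec R).Modules} {ι : Type*}
    [Finite ι] (hM : IsTilde M) (b : Module.Basis ι Γ(Spec R, ⊤) Γ(M, ⊤)) : IsFrame M ⊤ b := by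
  let f : R ≃+* Γ(Spec R, ⊤) := RingEquiv.ofBijective (algebraMap R Γ(Spec R, ⊤))
    ((ConcreteCategory.isIso_iff_bijective (Scheme.ΓSpecIso R).inv).1 inferInstance)
  have hf (c : Γ(Spec R, ⊤)) (x : Γ(M, ⊤)) : f.symm c • x = c • x := by
    rw [← algebraMap_smul Γ(Spec R, ⊤) (f.symm c) x]
    exact congrArg (· • x) (f.apply_symm_apply c)
  have hb : ⇑(b.mapCoeffs f.symm hf) = b := funext (b.mapCoeffs_apply f.symm hf)
  exact hb ▸ isFrame_top_of_basis hM (b.mapCoeffs f.symm hf)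

variable {X : Scheme.{u}} {U : X.Opens} {M N : X.Modules}

theorem image_top_fromSpec (hU : IsAffineOpen U) : hU.fromSpec ''ᵁ ⊤ = U := by
  rw [Scheme.Hom.image_top_eq_opensRange, hU.opensRange_fromSpec]

theorem isFrame_of_bijective (hU : IsAffineOpen U) (hM : IsTilde (M.restrict hU.fromSpec))
    {ι : Type*} [Fintype ι] {b : ι → Γ(M, U)}
    (h : Function.Bijective fun a : ι → Γ(X, U) => ∑ i, a i • b i) : IsFrame M U b := by
  have key : ∀ (V : X.Opens) (_ : hU.fromSpec ''ᵁ ⊤ = V) (b : ι → Γ(M, V))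
      (_ : Function.Bijective fun a : ι → Γ(X, V) => ∑ i, a i • b i), IsFrame M V b := by
    rintro _ rfl b h
    have hiso : Function.Bijective (hU.fromSpec.appIso ⊤).inv :=
      (ConcreteCategory.isIso_iff_bijective _).1 inferInstance
    obtain ⟨B, hB⟩ := (exists_basis_iff_bijective (R := Γ(Spec _, ⊤))
      (M := Γ(M.restrict hU.fromSpec, ⊤)) b).2 (h.comp (.piMap fun _ : ι => hiso))
    obtain rfl : ⇑B = b := funext hB
    exact (isFrame_restrict_iff hU.fromSpec _).1 (isFrame_top_of_basis_sections hM B)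
  exact key U (image_top_fromSpec hU) b h

theorem app_surjective_of_epi (hU : IsAffineOpen U) (φ : M ⟶ N) [Epi φ]
    (hM : IsTilde (M.restrict hU.fromSpec)) (hN : IsTilde (N.restrict hU.fromSpec)) :
    Function.Surjective (φ.app U) := by
  have key : ∀ (V : X.Opens) (_ : hU.fromSpec ''ᵁ ⊤ = V), Function.Surjective (φ.app V) := by
    rintro _ rfl
    have : Epi ((Scheme.Modules.restrictFunctor hU.fromSpec).map φ) := inferInstance
    exact app_top_surjective_of_epi ((Scheme.Modules.restrictFunctor hU.fromSpec).map φ) hM hN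
  exact key U (image_top_fromSpec hU)

theorem IsLocallyFreeFiniteRank.exists_isFrame (hM : IsLocallyFreeFiniteRank M)
    (hU : IsAffineOpen U) [IsDomain Γ(X, U)] [IsPrincipalIdealRing Γ(X, U)] :
    ∃ (n : ℕ) (b : Fin n → Γ(M, U)), IsFrame M U b := by
  have hlocal : HasLocalFrames (M.restrict hU.fromSpec) := by
    intro x
    obtain ⟨r, hr⟩ := hM (hU.fromSpec x)
    obtain ⟨V, hx, b, hb⟩ := hasRankAt_iff.1 hr
    have h : hU.fromSpec ''ᵁ (hU.fromSpec ⁻¹ᵁ V) ≤ V := by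
      rw [Scheme.Hom.image_preimage_eq_opensRange_inf]
      exact inf_le_right
    exact ⟨hU.fromSpec ⁻¹ᵁ V, hx, r, _, (isFrame_restrict_iff hU.fromSpec _).2 (hb.restrict h)⟩
  obtain ⟨n, b, hb⟩ := exists_isFrame_top (hM.isTilde_restrict hU.fromSpec) hlocal
  exact ⟨n, _, ((isFrame_restrict_iff hU.fromSpec _).1 hb).restrict (image_top_fromSpec hU).ge⟩

end AffineOpen

section Exact

variable {X : Scheme.{u}} {S : ShortComplex X.Modules} {U : X.Opens} {ι κ : Type*}
  {b : ι → Γ(S.X₁, U)} {c : κ → Γ(S.X₂, U)}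

theorem g_app_f_app (S : ShortComplex X.Modules) (t : Γ(S.X₁, U)) :
    S.g.app U (S.f.app U t) = 0 := by
  rw [← ConcreteCategory.comp_apply, ← Scheme.Modules.Hom.comp_app, S.zero]
  rfl

theorem bijective_of_shortExact [Fintype ι] [Fintype κ] (hS : S.ShortExact)
    (hb : Function.Bijective fun a : ι → Γ(X, U) => ∑ i, a i • b i)
    (hc : Function.Bijective fun a : κ → Γ(X, U) => ∑ k, a k • S.g.app U (c k)) :
    Function.Bijective fun a : ι ⊕ κ → Γ(X, U) =>
      ∑ j, a j • Sum.elim (fun i => S.f.app U (b i)) c j := by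
  have := hS.mono_f
  have sum_eq (a : ι ⊕ κ → Γ(X, U)) : ∑ j, a j • Sum.elim (fun i => S.f.app U (b i)) c j =
      S.f.app U (∑ i, a (.inl i) • b i) + ∑ k, a (.inr k) • c k := by
    simp only [Fintype.sum_sum_type, Sum.elim_inl, Sum.elim_inr, app_sum_smul]
  constructor
  · intro a a' e
    simp only [sum_eq] at e
    have hκ : ∀ k, a (.inr k) = a' (.inr k) := by
      have := congrArg (S.g.app U) e
      simp only [map_add, g_app_f_app, zero_add] at this
      simp only [app_sum_smul] at this
      exact congrFun (hc.1 this)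
    simp only [hκ, add_left_inj] at e
    have hι : ∀ i, a (.inl i) = a' (.inl i) := congrFun (hb.1 (app_injective S.f U e))
    ext (i | k)
    exacts [hι i, hκ k]
  · intro s
    obtain ⟨a, ha : ∑ k, a k • S.g.app U (c k) = S.g.app U s⟩ := hc.2 (S.g.app U s)
    obtain ⟨t, ht⟩ := exists_app_eq_of_exact hS.exact (s - ∑ k, a k • c k) (by
      rw [map_sub, app_sum_smul, ha, sub_self])
    obtain ⟨a', rfl⟩ := hb.2 t
    exact ⟨Sum.elim a' a, (sum_eq _).trans (eq_sub_iff_add_eq.1 ht)⟩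

theorem isFrame_of_shortExact [Finite ι] [Finite κ] (hS : S.ShortExact)
    (hb : IsFrame S.X₁ U b) (hc : IsFrame S.X₃ U fun k => S.g.app U (c k)) :
    IsFrame S.X₂ U (Sum.elim (fun i => S.f.app U (b i)) c) := by
  have := Fintype.ofFinite ι
  have := Fintype.ofFinite κ
  refine isFrame_iff_bijective.2 fun W h => ?_
  convert bijective_of_shortExact hS (isFrame_iff_bijective.1 hb W h)
    (c := fun k => res S.X₂ h (c k))
    (by simpa only [app_res] using isFrame_iff_bijective.1 hc W h) using 5 with a j
  cases j <;> simp [app_res]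

theorem bijective_quotient [Fintype ι] [Fintype κ] (hS : S.ShortExact)
    (hb : Function.Bijective fun a : ι → Γ(X, U) => ∑ i, a i • b i)
    (hc : Function.Bijective fun a : ι ⊕ κ → Γ(X, U) =>
      ∑ j, a j • Sum.elim (fun i => S.f.app U (b i)) c j)
    (hsurj : Function.Surjective (S.g.app U)) :
    Function.Bijective fun a : κ → Γ(X, U) => ∑ k, a k • S.g.app U (c k) := by
  have := hS.mono_f
  constructor
  · intro a a' e
    simp only [← app_sum_smul] at e
    obtain ⟨t, ht⟩ := exists_app_eq_of_exact hS.exact (∑ k, a k • c k - ∑ k, a' k • c k) (by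
      rw [map_sub, e, sub_self])
    obtain ⟨β, rfl⟩ := hb.2 t
    have : Sum.elim β a' = Sum.elim (fun _ => 0) a := by
      apply hc.1
      simpa only [Fintype.sum_sum_type, Sum.elim_inl, Sum.elim_inr, app_sum_smul,
        zero_smul, Finset.sum_const_zero, zero_add] using eq_sub_iff_add_eq.1 ht
    exact funext fun k => (congrFun this (.inr k)).symm
  · intro s
    obtain ⟨t, rfl⟩ := hsurj s
    obtain ⟨a, rfl⟩ := hc.2 t
    refine ⟨fun k => a (.inr k), ?_⟩
    simp only [Fintype.sum_sum_type, Sum.elim_inl, Sum.elim_inr, ← app_sum_smul, map_add,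
      g_app_f_app, zero_add]

theorem isFrame_quotient [Finite ι] [Finite κ] (hS : S.ShortExact)
    (hU : IsAffineOpen U) (h₂ : IsTilde (S.X₂.restrict hU.fromSpec))
    (h₃ : IsTilde (S.X₃.restrict hU.fromSpec)) {e : ι → Γ(S.X₁, U)} {c : κ → Γ(S.X₂, U)}
    (he : IsFrame S.X₁ U e) (hc : IsFrame S.X₂ U (Sum.elim (fun i => S.f.app U (e i)) c)) :
    IsFrame S.X₃ U fun k => S.g.app U (c k) := by
  have := Fintype.ofFinite ι
  have := Fintype.ofFinite κ
  have := hS.epi_g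
  exact isFrame_of_bijective hU h₃ (bijective_quotient hS he.bijective hc.bijective
    (app_surjective_of_epi hU S.g h₂ h₃))

theorem exists_isTransition_fromBlocks {S : ShortComplex X.Modules} (hS : S.ShortExact)
    [Fintype ι] [Fintype κ] {ι' κ' : Type*} {b : ι → Γ(S.X₁, U)} {b' : ι' → Γ(S.X₁, U)}
    {c : κ → Γ(S.X₂, U)} {c' : κ' → Γ(S.X₂, U)} {A : Matrix ι ι' Γ(X, U)} {D : Matrix κ κ' Γ(X, U)}
    (hb : IsFrame S.X₁ U b) (hA : IsTransition b b' A)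
    (hD : IsTransition (fun k => S.g.app U (c k)) (fun k => S.g.app U (c' k)) D) :
    ∃ B, IsTransition (Sum.elim (fun i => S.f.app U (b i)) c)
      (Sum.elim (fun i => S.f.app U (b' i)) c') (Matrix.fromBlocks A B 0 D) := by
  have := hS.mono_f
  choose t ht using fun k => exists_app_eq_of_exact hS.exact (c' k - ∑ j, D j k • c j)
    (by rw [map_sub, app_sum_smul, ← hD k, sub_self])
  obtain ⟨B, hB⟩ := hb.exists_transition t
  refine ⟨B, Sum.rec (fun i => ?_) fun k => ?_⟩
  · simpa using hA.map S.f i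
  · have htB : S.f.app U (t k) = _ := hB.map S.f k
    simp [← htB, ht]

end Exact

/-! ### Coordinates on the projective line -/

section Coordinates

open MvPolynomial (aeval X)
open HomogeneousLocalization (Away)
open LaurentPolynomial (T)
open scoped Polynomial LaurentPolynomial

variable (K : Type u) [Field K]

/-- The grading of the homogeneous coordinate ring of the projective line. -/
abbrev grading : ℕ → Submodule K (MvPolynomial (Fin 2) K) :=
  MvPolynomial.homogeneousSubmodule (Fin 2) K

variable {K}

theorem X_mem_grading (i : Fin 2) : (X i : MvPolynomial (Fin 2) K) ∈ grading K 1 :=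
  MvPolynomial.isHomogeneous_X _ i

theorem X_pow_mem_grading (i : Fin 2) (n : ℕ) : (X i ^ n : MvPolynomial (Fin 2) K) ∈ grading K n :=
  MvPolynomial.isHomogeneous_X_pow i n

theorem X_mul_X_mem_grading : (X 0 * X 1 : MvPolynomial (Fin 2) K) ∈ grading K (1 + 1) :=
  (X_mem_grading 0).mul (X_mem_grading 1)

theorem aeval_mul_of_isHomogeneous {σ B : Type*} [CommRing B] [Algebra K B] {a : MvPolynomial σ K}
    {n : ℕ} (ha : a.IsHomogeneous n) (c : B) (v : σ → B) :
    aeval (fun k => c * v k) a = c ^ n * aeval v a := by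
  simp only [MvPolynomial.aeval_def, MvPolynomial.eval₂_eq, Finset.mul_sum]
  refine Finset.sum_congr rfl fun d hd => ?_
  have hdeg : d.degree = n := by
    by_contra h
    exact MvPolynomial.mem_support_iff.1 hd (ha.coeff_eq_zero h)
  simp only [mul_pow, Finset.prod_mul_distrib, Finset.prod_pow_eq_pow_sum]
  rw [← Finsupp.degree_apply, hdeg]
  ring

theorem aeval_eq_of_isHomogeneous {σ B C : Type*} [CommRing B] [Algebra K B] [CommRing C]
    [Algebra K C] {v : σ → B} {w : σ → C} (ψ : B →ₐ[K] C) {c : C} (hw : ∀ k, w k = c * ψ (v k))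
    {n : ℕ} {a : MvPolynomial σ K} (ha : a.IsHomogeneous n) :
    aeval w a = c ^ n * ψ (aeval v a) := by
  rw [funext hw, aeval_mul_of_isHomogeneous ha, MvPolynomial.comp_aeval_apply]

section AwayEval

variable {B C : Type*} [CommRing B] [Algebra K B] [CommRing C] [Algebra K C]
variable {f : MvPolynomial (Fin 2) K} (v : Fin 2 → B)

/-- Evaluation of a fraction `a / f ^ n` of degree zero at a point where `f` is invertible. -/
def awayEval (hu : IsUnit (aeval v f)) : Away (grading K) f →+* B :=
  (Localization.awayLift (aeval v).toRingHom f hu).comp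
    (algebraMap (Away (grading K) f) (Localization.Away f))

theorem awayEval_mk (hu : IsUnit (aeval v f)) {d : ℕ} (hf : f ∈ grading K d) (n : ℕ)
    (a : MvPolynomial (Fin 2) K) (ha : a ∈ grading K (n • d)) :
    awayEval v hu (.mk _ hf n a ha) * aeval v f ^ n = aeval v a := by
  obtain ⟨w, hw⟩ := isUnit_iff_exists_inv.1 hu
  have h : awayEval v hu (.mk _ hf n a ha) = aeval v a * w ^ n :=
    Localization.awayLift_mk (aeval v).toRingHom f a w hw n
  rw [h, mul_assoc, ← mul_pow, mul_comm w, hw, one_pow, mul_one]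

theorem awayEval_injective (hu : IsUnit (aeval v f)) {d : ℕ} (hf : f ∈ grading K d)
    (hv : ∀ (n : ℕ) (a : MvPolynomial (Fin 2) K), a ∈ grading K n → aeval v a = 0 → a = 0) :
    Function.Injective (awayEval v hu) := by
  rw [injective_iff_map_eq_zero]
  intro z hz
  obtain ⟨n, a, ha, rfl⟩ := Away.mk_surjective _ hf z
  have h := awayEval_mk v hu hf n a ha
  rw [hz, zero_mul] at h
  obtain rfl := hv _ a ha h.symm
  ext
  simp [Localization.mk_zero]

theorem algebraMap_mem_range_awayEval (hu : IsUnit (aeval v f)) {d : ℕ} (hf : f ∈ grading K d)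
    (c : K) : algebraMap K B c ∈ (awayEval v hu).range := by
  have hc : MvPolynomial.C c ∈ grading K (0 • d) := by
    rw [zero_smul]
    exact MvPolynomial.isHomogeneous_C _ c
  exact ⟨.mk _ hf 0 _ hc, by simpa using awayEval_mk v hu hf 0 _ hc⟩

variable {v}

theorem eq_zero_of_aeval_eq_zero {c : FractionRing (MvPolynomial (Fin 2) K)}
    (ψ : B →ₐ[K] FractionRing (MvPolynomial (Fin 2) K))
    (hψ : ∀ k, algebraMap (MvPolynomial (Fin 2) K) _ (X k) = c * ψ (v k)) (n : ℕ)
    (a : MvPolynomial (Fin 2) K) (ha : a ∈ grading K n) (h : aeval v a = 0) : a = 0 := by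
  refine FaithfulSMul.algebraMap_injective _ (FractionRing (MvPolynomial (Fin 2) K)) ?_
  have ha' := MvPolynomial.aeval_algebraMap_apply (FractionRing (MvPolynomial (Fin 2) K))
    (X : Fin 2 → MvPolynomial (Fin 2) K) a
  rw [MvPolynomial.aeval_X_left_apply] at ha'
  rw [← ha', map_zero]
  exact (aeval_eq_of_isHomogeneous ψ hψ ha).trans (by rw [h, map_zero, mul_zero])

theorem awayEval_awayMap {w : Fin 2 → C} {c : C} (ψ : B →ₐ[K] C) (hw : ∀ k, w k = c * ψ (v k))
    {g x : MvPolynomial (Fin 2) K} {d e : ℕ} (hf : f ∈ grading K d) (hg : g ∈ grading K e)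
    (hx : x = f * g) (hu : IsUnit (aeval v f)) (hu' : IsUnit (aeval w x))
    (z : Away (grading K) f) :
    awayEval w hu' (HomogeneousLocalization.awayMap (grading K) hg hx z) =
      ψ (awayEval v hu z) := by
  obtain ⟨n, a, ha, rfl⟩ := Away.mk_surjective _ hf z
  have hxd : x ∈ grading K (d + e) := hx ▸ hf.mul hg
  have hgn : g ^ n ∈ grading K (n • e) := SetLike.pow_mem_graded n hg
  have hv := congrArg ψ (awayEval_mk v hu hf n a ha)
  have hw' := awayEval_mk w hu' hxd n (a * g ^ n) (by rw [smul_add]; exact ha.mul hgn)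
  rw [HomogeneousLocalization.awayMap_mk]
  refine (hu'.pow n).mul_right_cancel (hw'.trans ?_)
  rw [map_mul, aeval_eq_of_isHomogeneous ψ hw ha, ← hv, hx, map_mul (aeval w),
    aeval_eq_of_isHomogeneous ψ hw hf]
  simp only [map_mul, map_pow, smul_eq_mul]
  ring

end AwayEval

variable (K) in
/-- The point of the chart `xᵢ ≠ 0` with homogeneous coordinates `xᵢ = 1` and an indeterminate. -/
def chartPoint (i : Fin 2) : Fin 2 → K[X] :=
  fun k => if k = i then 1 else Polynomial.X

variable (K) in
/-- The point `[T : 1]` of the intersection of the two charts. -/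
def overlapPoint : Fin 2 → K[T;T⁻¹] :=
  ![T 1, 1]

theorem isUnit_aeval_chartPoint (i : Fin 2) :
    IsUnit (aeval (chartPoint K i) (X i : MvPolynomial (Fin 2) K)) := by
  simp [chartPoint]

theorem isUnit_aeval_overlapPoint :
    IsUnit (aeval (overlapPoint K) (X 0 * X 1 : MvPolynomial (Fin 2) K)) := by
  simpa [overlapPoint] using LaurentPolynomial.isUnit_T 1

theorem overlapPoint_eq_toLaurent (k : Fin 2) :
    overlapPoint K k = overlapPoint K 1 * Polynomial.toLaurentAlg (chartPoint K 1 k) := by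
  fin_cases k <;> simp [overlapPoint, chartPoint]

theorem overlapPoint_eq_invert_toLaurent (k : Fin 2) :
    overlapPoint K k = overlapPoint K 0 *
      (LaurentPolynomial.invert.toAlgHom.comp Polynomial.toLaurentAlg) (chartPoint K 0 k) := by
  fin_cases k
  · simp [overlapPoint, chartPoint]
  · have hT : (T 1 * T (-1) : K[T;T⁻¹]) = 1 := by
      rw [← LaurentPolynomial.T_add, add_neg_cancel, LaurentPolynomial.T_zero]
    simp [overlapPoint, chartPoint, hT]

theorem eq_zero_of_aeval_chartPoint_eq_zero (i : Fin 2) (n : ℕ) (a : MvPolynomial (Fin 2) K)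
    (ha : a ∈ grading K n) (h : aeval (chartPoint K i) a = 0) : a = 0 := by
  let x (k : Fin 2) : FractionRing (MvPolynomial (Fin 2) K) :=
    algebraMap (MvPolynomial (Fin 2) K) _ (X k)
  have hx : x i ≠ 0 := by simp [x]
  refine eq_zero_of_aeval_eq_zero (c := x i) (Polynomial.aeval (x (1 - i) / x i)) (fun k => ?_)
    n a ha h
  by_cases hk : k = i
  · simp [hk, chartPoint, x]
  · obtain rfl : k = 1 - i := by omega
    simp [hk, chartPoint, x, mul_div_cancel₀ _ hx]

theorem awayEval_chartPoint_bijective (i : Fin 2) :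
    Function.Bijective (awayEval (chartPoint K i) (isUnit_aeval_chartPoint (K := K) i)) := by
  have hmem := X_mem_grading (K := K) i
  refine ⟨awayEval_injective _ _ hmem (eq_zero_of_aeval_chartPoint_eq_zero i), ?_⟩
  have hi : 1 - i ≠ i := by fin_cases i <;> decide
  have hX : Polynomial.X ∈ (awayEval (chartPoint K i) (isUnit_aeval_chartPoint (K := K) i)).range :=
    ⟨.mk _ hmem 1 (X (1 - i)) (X_mem_grading _), by
      simpa [chartPoint, hi] using awayEval_mk (chartPoint K i) (isUnit_aeval_chartPoint i)
        hmem 1 (X (1 - i)) (X_mem_grading _)⟩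
  rw [← RingHom.range_eq_top, eq_top_iff]
  rintro p -
  induction p using Polynomial.induction_on' with
  | add p q hp hq => exact add_mem hp hq
  | monomial n c =>
    rw [← Polynomial.C_mul_X_pow_eq_monomial]
    exact mul_mem (algebraMap_mem_range_awayEval _ _ hmem c) (pow_mem hX n)

/-- The fraction `x₀ ^ a x₁ ^ b / (x₀ x₁) ^ n`. -/
def monomialFraction (n a b : ℕ) (h : a + b = n • (1 + 1)) : Away (grading K) (X 0 * X 1) :=
  .mk _ X_mul_X_mem_grading n (X 0 ^ a * X 1 ^ b)
    (h ▸ (X_pow_mem_grading 0 a).mul (X_pow_mem_grading 1 b))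

theorem awayEval_monomialFraction (n a b : ℕ) (h : a + b = n • (1 + 1)) :
    awayEval (overlapPoint K) isUnit_aeval_overlapPoint (monomialFraction n a b h) =
      T ((a : ℤ) - n) := by
  have := awayEval_mk (overlapPoint K) isUnit_aeval_overlapPoint
    X_mul_X_mem_grading n (X 0 ^ a * X 1 ^ b)
    (h ▸ (X_pow_mem_grading 0 a).mul (X_pow_mem_grading 1 b))
  simp only [overlapPoint, map_mul, MvPolynomial.aeval_X, map_pow, Matrix.cons_val_zero,
    Matrix.cons_val_one, one_pow, mul_one, LaurentPolynomial.T_pow] at this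
  rw [LaurentPolynomial.T_sub, ← this, mul_assoc, ← LaurentPolynomial.T_add]
  simp [monomialFraction, overlapPoint]

theorem awayEval_overlapPoint_bijective :
    Function.Bijective (awayEval (overlapPoint K) isUnit_aeval_overlapPoint) := by
  constructor
  · refine awayEval_injective _ _ X_mul_X_mem_grading fun n a ha h => ?_
    rw [aeval_eq_of_isHomogeneous _ overlapPoint_eq_toLaurent ha] at h
    refine eq_zero_of_aeval_chartPoint_eq_zero 1 n a ha ?_
    simpa only [overlapPoint, Matrix.cons_val_one, Matrix.cons_val_fin_one, one_pow, one_mul,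
      Polynomial.toLaurentAlg_apply, Polynomial.toLaurent_eq_zero] using h
  · rw [← RingHom.range_eq_top, eq_top_iff]
    rintro p -
    induction p using LaurentPolynomial.induction_on' with
    | add p q hp hq => exact add_mem hp hq
    | C_mul_T n c =>
      refine mul_mem (algebraMap_mem_range_awayEval _ _ X_mul_X_mem_grading c)
        ⟨monomialFraction n.natAbs (n.natAbs + n).toNat (n.natAbs - n).toNat ?_, ?_⟩
      · rw [smul_eq_mul]
        omega
      · rw [awayEval_monomialFraction]
        congr 1
        omega

end Coordinates

section TwistFrames

variable {A σ : Type u} [CommRing A] [SetLike σ A] [AddSubgroupClass σ A]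
variable {𝒜 : ℕ → σ} [GradedRing 𝒜] {d : ℤ} {U W : (Proj 𝒜).Opens} {f : A}

/-- The value of a section of a twisting sheaf at a point, in the localization at that point. -/
def twistEval (s : Γ(twist 𝒜 d, U)) (x : ProjectiveSpectrum 𝒜) (hx : x ∈ U) : LocAt 𝒜 x :=
  Subtype.val (p := fun f => f ∈ twistSections 𝒜 d U) s ⟨x, hx⟩

/-- The value of a function at a point, in the degree zero part of the localization at that
point. -/
def projEval (s : Γ(Proj 𝒜, U)) (x : ProjectiveSpectrum 𝒜) (hx : x ∈ U) :
    HomogeneousLocalization.AtPrime 𝒜 x.asHomogeneousIdeal.toIdeal :=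
  (show (ProjectiveSpectrum.Proj.structureSheaf 𝒜).1.obj (op U) from s).1 ⟨x, hx⟩

theorem twistEval_ext {s t : Γ(twist 𝒜 d, U)} (h : ∀ x hx, twistEval s x hx = twistEval t x hx) :
    s = t :=
  Subtype.ext (p := fun f => f ∈ twistSections 𝒜 d U) (funext fun x => h x.1 x.2)

theorem projEval_ext {s t : Γ(Proj 𝒜, U)} (h : ∀ x hx, projEval s x hx = projEval t x hx) :
    s = t :=
  Proj.ext 𝒜 (V := op U) s t (funext fun x => h x.1 x.2)

variable (d) in
/-- The section `f ^ d` of `𝒪(d)` over the set where `f` does not vanish. For negative `d` it is a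
fraction; the encoding has `f ^ d.toNat` as numerator and `f ^ (-d).toNat` as denominator, at least
one of which is `1`. -/
def twistPow (hf : f ∈ 𝒜 1) : Γ(twist 𝒜 d, Proj.basicOpen 𝒜 f) :=
  show twistSections 𝒜 d (Proj.basicOpen 𝒜 f) from
  ⟨fun x => Localization.mk (f ^ d.toNat)
      ⟨f ^ (-d).toNat, pow_mem (show f ∈ complAt 𝒜 x.1 from x.2) _⟩,
    fun x => ⟨Proj.basicOpen 𝒜 f, x.2, 𝟙 _, d.toNat, (-d).toNat,
      ⟨f ^ d.toNat, by simpa using SetLike.pow_mem_graded d.toNat hf⟩,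
      ⟨f ^ (-d).toNat, by simpa using SetLike.pow_mem_graded (-d).toNat hf⟩, by omega,
      fun y => ⟨pow_mem (show f ∈ complAt 𝒜 y.1 from y.2) _, rfl⟩⟩⟩

theorem twistEval_twistPow (hf : f ∈ 𝒜 1) (x : ProjectiveSpectrum 𝒜)
    (hx : x ∈ Proj.basicOpen 𝒜 f) : twistEval (twistPow d hf) x hx =
      Localization.mk (f ^ d.toNat)
        ⟨f ^ (-d).toNat, pow_mem (show f ∈ complAt 𝒜 x from hx) _⟩ :=
  rfl

theorem isUnit_twistEval_twistPow (hf : f ∈ 𝒜 1) (x : ProjectiveSpectrum 𝒜)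
    (hx : x ∈ Proj.basicOpen 𝒜 f) : IsUnit (twistEval (twistPow d hf) x hx) := by
  have hx' : f ∈ complAt 𝒜 x := hx
  refine IsUnit.of_mul_eq_one
    (Localization.mk (f ^ (-d).toNat) ⟨f ^ d.toNat, pow_mem hx' _⟩) ?_
  rw [twistEval_twistPow, Localization.mk_mul]
  have h : f ^ d.toNat * f ^ (-d).toNat ∈ complAt 𝒜 x :=
    mul_mem (pow_mem hx' _) (pow_mem hx' _)
  convert Localization.mk_self (⟨_, h⟩ : complAt 𝒜 x) using 2
  exact Subtype.ext (mul_comm _ _)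

theorem exists_mk_val_mul_twistEval_twistPow (hf : f ∈ 𝒜 1) {i j : ℕ} (a : 𝒜 i) (b : 𝒜 j)
    (hij : (i : ℤ) - j = d) :
    ∃ (m : ℕ) (a' b' : 𝒜 m), ∀ (x : ProjectiveSpectrum 𝒜) (hx : x ∈ Proj.basicOpen 𝒜 f)
      (hb : (b : A) ∈ complAt 𝒜 x), ∃ hb' : (b' : A) ∈ complAt 𝒜 x,
        (HomogeneousLocalization.mk ⟨m, a', b', hb'⟩ :
          HomogeneousLocalization 𝒜 (complAt 𝒜 x)).val * twistEval (twistPow d hf) x hx =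
            Localization.mk (a : A) ⟨b, hb⟩ := by
  have hpow (n : ℕ) : f ^ n ∈ 𝒜 n := by simpa using SetLike.pow_mem_graded n hf
  refine ⟨i + (-d).toNat, ⟨a * f ^ (-d).toNat, SetLike.mul_mem_graded a.2 (hpow _)⟩,
    ⟨b * f ^ d.toNat, ?_⟩,
    fun x hx hb => ⟨mul_mem hb (pow_mem (show f ∈ complAt 𝒜 x from hx) _), ?_⟩⟩
  · rw [show i + (-d).toNat = j + d.toNat by omega]
    exact SetLike.mul_mem_graded b.2 (hpow _)
  · rw [twistEval_twistPow, HomogeneousLocalization.val_mk, Localization.mk_mul,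
      Localization.mk_eq_mk_iff, Localization.r_iff_exists]
    refine ⟨1, ?_⟩
    simp only [Submonoid.coe_one, one_mul, Submonoid.coe_mul]
    ring

theorem exists_smul_res_twistPow_eq (hf : f ∈ 𝒜 1) (h : W ≤ Proj.basicOpen 𝒜 f)
    (s : Γ(twist 𝒜 d, W)) : ∃ g : Γ(Proj 𝒜, W), g • res (twist 𝒜 d) h (twistPow d hf) = s := by
  have hloc (x : W) : ∃ (V : (Proj 𝒜).Opens) (_ : x.1 ∈ V) (hV : V ≤ W) (m : ℕ) (a b : 𝒜 m),
      ∀ y (hy : y ∈ V), ∃ hb : (b : A) ∈ complAt 𝒜 y,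
        (HomogeneousLocalization.mk ⟨m, a, b, hb⟩ :
          HomogeneousLocalization 𝒜 (complAt 𝒜 y)).val *
            twistEval (twistPow d hf) y (h (hV hy)) = twistEval s y (hV hy) := by
    obtain ⟨V, hxV, iV, i, j, a, b, hij, w⟩ := (show twistSections 𝒜 d W from s).2 x
    obtain ⟨m, a', b', hab⟩ := exists_mk_val_mul_twistEval_twistPow hf a b hij
    refine ⟨V, hxV, iV.le, m, a', b', fun y hy => ?_⟩
    obtain ⟨hb, e⟩ := w ⟨y, hy⟩
    obtain ⟨hb', e'⟩ := hab y (h (iV.le hy)) hb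
    exact ⟨hb', e'.trans e.symm⟩
  have hval (x : W) : ∃ g : HomogeneousLocalization 𝒜 (complAt 𝒜 x.1),
      g.val * twistEval (twistPow d hf) x.1 (h x.2) = twistEval s x.1 x.2 := by
    obtain ⟨V, hxV, hV, m, a, b, w⟩ := hloc x
    exact ⟨_, (w x.1 hxV).2⟩
  choose g hg using hval
  refine ⟨show (ProjectiveSpectrum.Proj.structureSheaf 𝒜).1.obj (op W) from ⟨g, fun x => ?_⟩,
    twistEval_ext fun x hx => hg ⟨x, hx⟩⟩
  obtain ⟨V, hxV, hV, m, a, b, w⟩ := hloc x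
  refine ⟨V, hxV, homOfLE hV, m, a, b, fun y => (w y.1 y.2).1, fun y => ?_⟩
  refine HomogeneousLocalization.val_injective _ ?_
  exact (isUnit_twistEval_twistPow hf y.1 (h (hV y.2))).mul_right_cancel
    ((hg ⟨y.1, hV y.2⟩).trans (w y.1 y.2).2.symm)

theorem isFrame_twistPow (hf : f ∈ 𝒜 1) :
    IsFrame (twist 𝒜 d) (Proj.basicOpen 𝒜 f) fun _ : Unit => twistPow d hf := by
  rw [isFrame_iff_bijective]
  intro W h
  simp only [Finset.univ_unique, Finset.sum_singleton]
  constructor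
  · intro a a' e
    funext i
    refine projEval_ext fun x hx => HomogeneousLocalization.val_injective _ ?_
    have := congrArg (fun s => twistEval s x hx) e
    exact (isUnit_twistEval_twistPow hf x (h hx)).mul_right_cancel this
  · intro s
    obtain ⟨g, hg⟩ := exists_smul_res_twistPow_eq hf h s
    exact ⟨fun _ => g, hg⟩

end TwistFrames

section Charts

open MvPolynomial (X)
open LaurentPolynomial (T)
open scoped Polynomial LaurentPolynomial

variable (K : Type u) [Field K]

/-- The affine open set `xᵢ ≠ 0` of the projective line. -/
def chart (i : Fin 2) : (P1 K).Opens :=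
  Proj.basicOpen (grading K) (X i)

theorem basicOpen_X_mul_X :
    Proj.basicOpen (grading K) (X 0 * X 1) = chart K 0 ⊓ chart K 1 :=
  Proj.basicOpen_mul ..

theorem isAffineOpen_chart (i : Fin 2) : IsAffineOpen (chart K i) :=
  Proj.isAffineOpen_basicOpen _ _ (X_mem_grading i) one_pos

theorem chart_sup : chart K 0 ⊔ chart K 1 = ⊤ := by
  have hsup : ⨆ i, chart K i ≤ chart K 0 ⊔ chart K 1 := iSup_le fun i => by
    fin_cases i
    exacts [le_sup_left, le_sup_right]
  refine top_le_iff.1 (hsup.trans' (ge_of_eq ?_))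
  refine Proj.iSup_basicOpen_eq_top' (grading K) X (fun i => ⟨1, X_mem_grading i⟩)
    (eq_top_iff.2 fun p _ => ?_)
  induction p using MvPolynomial.induction_on with
  | C c =>
    exact Subalgebra.algebraMap_mem _
      (⟨MvPolynomial.C c, MvPolynomial.isHomogeneous_C _ c⟩ : grading K 0)
  | add p q hp hq => exact add_mem (hp trivial) (hq trivial)
  | mul_X p i hp => exact mul_mem (hp trivial) (Algebra.subset_adjoin ⟨i, rfl⟩)

variable {K} in
/-- Functions on the complement of a homogeneous hypersurface are fractions of degree zero. -/
def sectionEquiv {f : MvPolynomial (Fin 2) K} {d : ℕ} (hf : f ∈ grading K d) (hd : 0 < d) :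
    HomogeneousLocalization.Away (grading K) f ≃+* Γ(P1 K, Proj.basicOpen (grading K) f) :=
  (Proj.basicOpenIsoAway (grading K) f hf hd).commRingCatIsoToRingEquiv

variable {K} in
theorem resFun_sectionEquiv {f g x : MvPolynomial (Fin 2) K} {d e m : ℕ} (hf : f ∈ grading K d)
    (hd : 0 < d) (hg : g ∈ grading K e) (hx : x = f * g) (hm : x ∈ grading K m) (hm' : 0 < m)
    (h : Proj.basicOpen (grading K) x ≤ Proj.basicOpen (grading K) f) (z) :
    resFun h (sectionEquiv hf hd z) =
      sectionEquiv hm hm' (HomogeneousLocalization.awayMap (grading K) hg hx z) :=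
  (ConcreteCategory.congr_hom (Proj.awayMap_awayToSection (grading K) hg hx) z).symm

/-- The identification of the functions on the chart `xᵢ ≠ 0` with polynomials in the quotient of
the other homogeneous coordinate by `xᵢ`. -/
def coord (i : Fin 2) : Γ(P1 K, chart K i) ≃+* K[X] :=
  (sectionEquiv (X_mem_grading i) one_pos).symm.trans
    (.ofBijective _ (awayEval_chartPoint_bijective i))

instance (i : Fin 2) : IsDomain Γ(P1 K, chart K i) :=
  (coord K i).toMulEquiv.isDomain

instance (i : Fin 2) : IsPrincipalIdealRing Γ(P1 K, chart K i) :=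
  .of_surjective (coord K i).symm.toRingHom (coord K i).symm.surjective

/-- The ring isomorphism induced by an equality of open sets. -/
def resFunEquiv {X : Scheme.{u}} {U V : X.Opens} (h : U = V) : Γ(X, U) ≃+* Γ(X, V) :=
  RingEquiv.ofRingHom (resFun h.ge) (resFun h.le) (by ext; simp [resFun_resFun])
    (by ext; simp [resFun_resFun])

/-- The identification of the functions where `x₀ x₁ ≠ 0` with Laurent polynomials in
`T = x₀ / x₁`. -/
def coordOverlap : Γ(P1 K, chart K 0 ⊓ chart K 1) ≃+* K[T;T⁻¹] :=
  (resFunEquiv (basicOpen_X_mul_X K)).symm.trans <|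
    (sectionEquiv X_mul_X_mem_grading two_pos).symm.trans
      (.ofBijective _ awayEval_overlapPoint_bijective)

theorem coordOverlap_resFun_sectionEquiv (z) :
    coordOverlap K (resFun (basicOpen_X_mul_X K).ge
      (sectionEquiv X_mul_X_mem_grading two_pos z)) =
      awayEval (overlapPoint K) isUnit_aeval_overlapPoint z := by
  have : resFun (basicOpen_X_mul_X K).ge (sectionEquiv X_mul_X_mem_grading two_pos z) =
    resFunEquiv (basicOpen_X_mul_X K) (sectionEquiv X_mul_X_mem_grading two_pos z) := rfl
  rw [this, coordOverlap, RingEquiv.trans_apply, RingEquiv.symm_apply_apply,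
    RingEquiv.trans_apply, RingEquiv.symm_apply_apply]
  rfl

variable {K} in
theorem coordOverlap_resFun {i j : Fin 2}
    (hx : (X 0 * X 1 : MvPolynomial (Fin 2) K) = X i * X j)
    (h : chart K 0 ⊓ chart K 1 ≤ chart K i) {ψ : K[X] →ₐ[K] K[T;T⁻¹]}
    (hψ : ∀ k, overlapPoint K k = overlapPoint K i * ψ (chartPoint K i k))
    (z : Γ(P1 K, chart K i)) : coordOverlap K (resFun h z) = ψ (coord K i z) := by
  obtain ⟨z, rfl⟩ := (sectionEquiv (X_mem_grading i) one_pos).surjective z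
  have hz : coord K i (sectionEquiv (X_mem_grading i) one_pos z) =
      awayEval (chartPoint K i) (isUnit_aeval_chartPoint i) z :=
    congrArg (awayEval _ (isUnit_aeval_chartPoint i))
      ((sectionEquiv (X_mem_grading i) one_pos).symm_apply_apply z)
  rw [hz, ← awayEval_awayMap ψ hψ (X_mem_grading i) (X_mem_grading j) hx _
      isUnit_aeval_overlapPoint, ← coordOverlap_resFun_sectionEquiv,
    ← resFun_sectionEquiv (X_mem_grading i) one_pos (X_mem_grading j) hx X_mul_X_mem_grading
      two_pos ((basicOpen_X_mul_X K).le.trans h)]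
  exact congrArg _ (resFun_resFun ..).symm

theorem coordOverlap_zero (z : Γ(P1 K, chart K 0)) :
    coordOverlap K (resFun inf_le_left z) =
      LaurentPolynomial.invert (coord K 0 z).toLaurent :=
  coordOverlap_resFun rfl inf_le_left overlapPoint_eq_invert_toLaurent z

theorem coordOverlap_one (z : Γ(P1 K, chart K 1)) :
    coordOverlap K (resFun inf_le_right z) = (coord K 1 z).toLaurent :=
  coordOverlap_resFun (mul_comm _ _) inf_le_right overlapPoint_eq_toLaurent z

variable (d : ℤ)

/-- The section `xᵢ ^ d` of `𝒪(d)` on the chart `xᵢ ≠ 0`. -/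
def powSection (i : Fin 2) : Γ(O K d, chart K i) :=
  twistPow d (X_mem_grading i)

theorem isFrame_powSection (i : Fin 2) :
    IsFrame (O K d) (chart K i) fun _ : Unit => powSection K d i :=
  isFrame_twistPow (X_mem_grading i)

theorem res_powSection_zero :
    res (O K d) (inf_le_left : chart K 0 ⊓ chart K 1 ≤ _) (powSection K d 0) =
      (coordOverlap K).symm (T d) •
        res (O K d) (inf_le_right : chart K 0 ⊓ chart K 1 ≤ _) (powSection K d 1) := by
  -- `Tᵈ` is the fraction `x₀ ^ (2d) / (x₀ x₁) ^ d`, or `x₁ ^ (-2d) / (x₀ x₁) ^ (-d)` if `d < 0`.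
  have hT : (T d : K[T;T⁻¹]) = T (((d.toNat + d.toNat : ℕ) : ℤ) - (d.toNat + (-d).toNat : ℕ)) := by
    congr 1
    omega
  rw [hT, ← awayEval_monomialFraction _ _ ((-d).toNat + (-d).toNat) (by rw [smul_eq_mul]; omega),
    ← coordOverlap_resFun_sectionEquiv, RingEquiv.symm_apply_apply]
  refine twistEval_ext fun x hx => ?_
  have h0 : X 0 ∈ complAt (grading K) x := hx.1
  have h1 : X 1 ∈ complAt (grading K) x := hx.2
  have key : (Localization.mk (X 0 ^ d.toNat) ⟨X 0 ^ (-d).toNat, pow_mem h0 _⟩ :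
        LocAt (grading K) x) =
      Localization.mk (X 0 ^ (d.toNat + d.toNat) * X 1 ^ ((-d).toNat + (-d).toNat))
        ⟨_, pow_mem (mul_mem h0 h1) (d.toNat + (-d).toNat)⟩ *
      Localization.mk (X 1 ^ d.toNat) ⟨X 1 ^ (-d).toNat, pow_mem h1 _⟩ := by
    rw [Localization.mk_mul, Localization.mk_eq_mk_iff, Localization.r_iff_exists]
    refine ⟨1, ?_⟩
    simp only [Submonoid.coe_one, one_mul, Submonoid.coe_mul]
    ring
  exact key

end Charts

/-! ### Rank and degree -/

section LaurentUnits

open LaurentPolynomial (C T)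
open scoped Polynomial LaurentPolynomial

variable {K : Type u} [Field K]

theorem exists_eq_C_mul_T_of_isUnit {u : K[T;T⁻¹]} (hu : IsUnit u) :
    ∃ (c : K) (n : ℤ), c ≠ 0 ∧ u = C c * T n := by
  obtain ⟨v, huv⟩ := isUnit_iff_exists_inv.1 hu
  obtain ⟨N, p, hp⟩ := u.exists_T_pow
  obtain ⟨M, q, hq⟩ := v.exists_T_pow
  have hpq : p * q = Polynomial.X ^ (N + M) := by
    apply Polynomial.toLaurent_injective
    rw [map_mul, hp, hq, Polynomial.toLaurent_X_pow, Nat.cast_add, LaurentPolynomial.T_add]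
    linear_combination (T (N : ℤ) * T (M : ℤ)) * huv
  obtain ⟨i, -, hi⟩ := (dvd_prime_pow Polynomial.prime_X _).1 (Dvd.intro q hpq)
  obtain ⟨w, hw⟩ := hi.symm
  obtain ⟨c, hc, hcw⟩ := Polynomial.isUnit_iff.1 w.isUnit
  have huN : u * T N = C c * T i := by
    rw [← hp, ← hw, ← hcw, map_mul, Polynomial.toLaurent_X_pow, Polynomial.toLaurent_C, mul_comm]
  refine ⟨c, i - N, hc.ne_zero, ?_⟩
  rw [LaurentPolynomial.T_sub, ← mul_assoc, ← huN, LaurentPolynomial.mul_T_assoc, add_neg_cancel,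
    LaurentPolynomial.T_zero, mul_one]

theorem chart_inf_nonempty : ∃ x, x ∈ chart K 0 ⊓ chart K 1 := by
  by_contra! h
  have : (1 : Γ(P1 K, chart K 0 ⊓ chart K 1)) = 0 := eq_of_resFun_eq fun x hx => (h x hx).elim
  simpa using congrArg (coordOverlap K) this

/-- A function on the overlap of the charts which is a nonzero multiple of `(x₀ / x₁) ^ n`. -/
def IsMonomial (u : Γ(P1 K, chart K 0 ⊓ chart K 1)) (n : ℤ) : Prop :=
  ∃ c : K, c ≠ 0 ∧ coordOverlap K u = C c * T n

variable {u v : Γ(P1 K, chart K 0 ⊓ chart K 1)} {m n : ℤ}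

theorem exists_isMonomial (hu : IsUnit u) : ∃ n, IsMonomial u n := by
  obtain ⟨c, n, hc, h⟩ := exists_eq_C_mul_T_of_isUnit (hu.map (coordOverlap K))
  exact ⟨n, c, hc, h⟩

theorem IsMonomial.unique (hm : IsMonomial u m) (hn : IsMonomial u n) : m = n := by
  obtain ⟨c, hc, h⟩ := hm
  obtain ⟨c', hc', h'⟩ := hn
  have := congrArg LaurentPolynomial.degree (h.symm.trans h')
  rw [LaurentPolynomial.degree_C_mul_T _ _ hc, LaurentPolynomial.degree_C_mul_T _ _ hc'] at this
  exact_mod_cast this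

theorem IsMonomial.mul (hu : IsMonomial u m) (hv : IsMonomial v n) :
    IsMonomial (u * v) (m + n) := by
  obtain ⟨c, hc, h⟩ := hu
  obtain ⟨c', hc', h'⟩ := hv
  refine ⟨c * c', mul_ne_zero hc hc', ?_⟩
  rw [map_mul, h, h', map_mul, LaurentPolynomial.T_add]
  ring

theorem isMonomial_one : IsMonomial (1 : Γ(P1 K, chart K 0 ⊓ chart K 1)) 0 :=
  ⟨1, one_ne_zero, by simp⟩

theorem isMonomial_symm_T (n : ℤ) : IsMonomial ((coordOverlap K).symm (T n)) n :=
  ⟨1, one_ne_zero, by simp⟩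

theorem IsMonomial.prod {ι : Type*} (s : Finset ι) {u : ι → Γ(P1 K, chart K 0 ⊓ chart K 1)}
    {n : ι → ℤ} (h : ∀ i, IsMonomial (u i) (n i)) :
    IsMonomial (∏ i ∈ s, u i) (∑ i ∈ s, n i) := by
  classical
  induction s using Finset.induction_on with
  | empty => simpa using isMonomial_one
  | insert i s hi ih =>
    rw [Finset.prod_insert hi, Finset.sum_insert hi]
    exact (h i).mul ih

theorem isMonomial_resFun_zero {w : Γ(P1 K, chart K 0)} (hw : IsUnit w) :
    IsMonomial (resFun inf_le_left w) 0 := by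
  obtain ⟨c, hc, h⟩ := Polynomial.isUnit_iff.1 (hw.map (coord K 0))
  exact ⟨c, hc.ne_zero, by simp [coordOverlap_zero, ← h]⟩

theorem isMonomial_resFun_one {w : Γ(P1 K, chart K 1)} (hw : IsUnit w) :
    IsMonomial (resFun inf_le_right w) 0 := by
  obtain ⟨c, hc, h⟩ := Polynomial.isUnit_iff.1 (hw.map (coord K 1))
  exact ⟨c, hc.ne_zero, by simp [coordOverlap_one, ← h]⟩

end LaurentUnits

section Degree

open LaurentPolynomial (T)

variable {K : Type u} [Field K]

/-- `E` is a locally free sheaf of rank `n` on the projective line, and the determinant of its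
transition matrix between the standard charts is a monomial of order `δ`. This makes the degree
available without a splitting of `E`. -/
def HasRankDegree (E : (P1 K).Modules) (n : ℕ) (δ : ℤ) : Prop :=
  ∃ (b₀ : Fin n → Γ(E, chart K 0)) (b₁ : Fin n → Γ(E, chart K 1))
    (g : Matrix (Fin n) (Fin n) Γ(P1 K, chart K 0 ⊓ chart K 1)),
    IsFrame E _ b₀ ∧ IsFrame E _ b₁ ∧
    IsTransition (fun i => res E inf_le_right (b₁ i)) (fun i => res E inf_le_left (b₀ i)) g ∧
    IsMonomial g.det δ

variable {E F : (P1 K).Modules} {n n' : ℕ} {δ δ' : ℤ}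

theorem hasRankDegree_of_frames {ι : Type*} [Fintype ι] [DecidableEq ι]
    {b₀ : ι → Γ(E, chart K 0)} {b₁ : ι → Γ(E, chart K 1)}
    {g : Matrix ι ι Γ(P1 K, chart K 0 ⊓ chart K 1)} (h₀ : IsFrame E _ b₀) (h₁ : IsFrame E _ b₁)
    (hg : IsTransition (fun i => res E inf_le_right (b₁ i)) (fun i => res E inf_le_left (b₀ i)) g)
    (hδ : IsMonomial g.det δ) (hn : Fintype.card ι = n) : HasRankDegree E n δ := by
  let e : Fin n ≃ ι := (Fintype.equivFinOfCardEq hn).symm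
  refine ⟨_, _, g.submatrix e e, h₀.reindex e, h₁.reindex e, fun k => ?_, ?_⟩
  · rw [hg (e k), ← e.sum_comp]
    rfl
  · rwa [Matrix.det_submatrix_equiv_self]

theorem exists_hasRankDegree (hE : IsLocallyFreeFiniteRank E) : ∃ n δ, HasRankDegree E n δ := by
  obtain ⟨n, b₀, h₀⟩ := hE.exists_isFrame (isAffineOpen_chart K 0)
  obtain ⟨m, b₁, h₁⟩ := hE.exists_isFrame (isAffineOpen_chart K 1)
  have r₀ := h₀.restrict (inf_le_left : chart K 0 ⊓ chart K 1 ≤ _)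
  have r₁ := h₁.restrict (inf_le_right : chart K 0 ⊓ chart K 1 ≤ _)
  obtain ⟨x, hx⟩ := chart_inf_nonempty (K := K)
  obtain rfl : n = m := by simpa using r₀.card_eq r₁ hx
  obtain ⟨g, hg⟩ := r₁.exists_transition fun i => res E inf_le_left (b₀ i)
  obtain ⟨δ, hδ⟩ := exists_isMonomial (r₁.isUnit_det r₀ hg)
  exact ⟨n, δ, b₀, b₁, g, h₀, h₁, hg, hδ⟩

theorem hasRank_of_frames {b₀ : Fin n → Γ(E, chart K 0)} {b₁ : Fin n → Γ(E, chart K 1)}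
    (h₀ : IsFrame E _ b₀) (h₁ : IsFrame E _ b₁) : HasRank E n := by
  intro x
  rw [hasRankAt_iff]
  rcases (chart_sup K).ge (Opens.mem_top x) with hx | hx
  · exact ⟨_, hx, b₀, h₀⟩
  · exact ⟨_, hx, b₁, h₁⟩

theorem HasRankDegree.hasRank (h : HasRankDegree E n δ) : HasRank E n := by
  obtain ⟨_, _, _, h₀, h₁, -⟩ := h
  exact hasRank_of_frames h₀ h₁

theorem HasRankDegree.rank_eq (h : HasRankDegree E n δ) (h' : HasRank E n') : n = n' := by
  obtain ⟨b₀, b₁, g, h₀, -⟩ := h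
  obtain ⟨x, hx⟩ := chart_inf_nonempty (K := K)
  obtain ⟨U, hxU, b, hb⟩ := hasRankAt_iff.1 (h' x)
  simpa using (h₀.restrict (inf_le_right : U ⊓ chart K 0 ≤ _)).card_eq
    (hb.restrict inf_le_left) ⟨hxU, hx.1⟩

theorem HasRank.exists_hasRankDegree (h : HasRank E n) : ∃ δ, HasRankDegree E n δ := by
  obtain ⟨n', δ, hδ⟩ := KTheoryP1.exists_hasRankDegree h.isLocallyFreeFiniteRank
  obtain rfl := hδ.rank_eq h
  exact ⟨δ, hδ⟩

theorem HasRankDegree.degree_eq (h : HasRankDegree E n δ) (h' : HasRankDegree E n δ') :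
    δ = δ' := by
  obtain ⟨b₀, b₁, g, h₀, h₁, hg, hδ⟩ := h
  obtain ⟨c₀, c₁, g', h₀', h₁', hg', hδ'⟩ := h'
  obtain ⟨A₀, hA₀⟩ := h₀.exists_transition c₀
  obtain ⟨A₁, hA₁⟩ := h₁.exists_transition c₁
  have hmul : g * A₀.map (resFun inf_le_left) = A₁.map (resFun inf_le_right) * g' :=
    (hg.mul (hA₀.restrict inf_le_left)).unique (h₁.restrict inf_le_right)
      ((hA₁.restrict inf_le_right).mul hg')
  have m₀ := isMonomial_resFun_zero (h₀.isUnit_det h₀' hA₀)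
  have m₁ := isMonomial_resFun_one (h₁.isUnit_det h₁' hA₁)
  rw [RingHom.map_det, RingHom.mapMatrix_apply] at m₀ m₁
  have hdet : IsMonomial (g.det * (A₀.map (resFun inf_le_left)).det) (0 + δ') := by
    rw [← Matrix.det_mul, hmul, Matrix.det_mul]
    exact m₁.mul hδ'
  simpa using (hδ.mul m₀).unique hdet

theorem HasRankDegree.map_iso (h : HasRankDegree E n δ) (e : E ≅ F) : HasRankDegree F n δ := by
  obtain ⟨b₀, b₁, g, h₀, h₁, hg, hδ⟩ := h
  refine ⟨_, _, g, h₀.map_iso e, h₁.map_iso e, ?_, hδ⟩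
  simpa only [app_res] using hg.map e.hom

theorem HasRankDegree.add {S : ShortComplex (P1 K).Modules} (hS : S.ShortExact)
    (hE : IsLocallyFreeFiniteRank S.X₂) (h : HasRankDegree S.X₁ n δ)
    (h' : HasRankDegree S.X₃ n' δ') : HasRankDegree S.X₂ (n + n') (δ + δ') := by
  have := hS.epi_g
  have surjective (i : Fin 2) : Function.Surjective (S.g.app (chart K i)) :=
    app_surjective_of_epi (isAffineOpen_chart K i) S.g (hE.isTilde_restrict _)
      (h'.hasRank.isLocallyFreeFiniteRank.isTilde_restrict _)
  obtain ⟨b₀, b₁, g, h₀, h₁, hg, hδ⟩ := h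
  obtain ⟨c₀, c₁, g', h₀', h₁', hg', hδ'⟩ := h'
  choose l₀ hl₀ using fun i => surjective 0 (c₀ i)
  choose l₁ hl₁ using fun i => surjective 1 (c₁ i)
  obtain rfl : (fun i => S.g.app _ (l₀ i)) = c₀ := funext hl₀
  obtain rfl : (fun i => S.g.app _ (l₁ i)) = c₁ := funext hl₁
  simp only [← app_res] at hg'
  obtain ⟨B, hB⟩ := exists_isTransition_fromBlocks hS (h₁.restrict inf_le_right) hg hg'
  simp only [app_res, ← Function.comp_def (res _ _), ← Sum.comp_elim] at hB
  refine hasRankDegree_of_frames (isFrame_of_shortExact hS h₀ h₀')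
    (isFrame_of_shortExact hS h₁ h₁') hB ?_ (by simp)
  rw [Matrix.det_fromBlocks_zero₂₁]
  exact hδ.mul hδ'

variable (K) in
/-- The section `xᵢ ^ dₖ` of the `k`-th summand of `𝒪(d₁) ⊕ ⋯ ⊕ 𝒪(dₑ)` on the chart `xᵢ ≠ 0`. -/
def splitSection {e : ℕ} (d : Fin e → ℤ) (i : Fin 2) (k : Fin e) : Γ(splitBundle K d, chart K i) :=
  (biproduct.ι (fun k => O K (d k)) k).app _ (powSection K (d k) i)

theorem isFrame_splitSection {e : ℕ} (d : Fin e → ℤ) (i : Fin 2) :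
    IsFrame (splitBundle K d) (chart K i) (splitSection K d i) :=
  (isFrame_biproduct _ fun k => isFrame_powSection K (d k) i).reindex (Equiv.sigmaUnique _ _).symm

theorem res_splitSection_zero {e : ℕ} (d : Fin e → ℤ) (k : Fin e) :
    res (splitBundle K d) (inf_le_left : chart K 0 ⊓ chart K 1 ≤ _) (splitSection K d 0 k) =
      (coordOverlap K).symm (T (d k)) • res _ inf_le_right (splitSection K d 1 k) := by
  rw [splitSection, splitSection, ← app_res, ← app_res, res_powSection_zero,
    Scheme.Modules.Hom.app_smul]

variable (K) in
theorem hasRankDegree_splitBundle {e : ℕ} (d : Fin e → ℤ) :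
    HasRankDegree (splitBundle K d) e (∑ i, d i) := by
  refine ⟨_, _, Matrix.diagonal fun k => (coordOverlap K).symm (T (d k)),
    isFrame_splitSection d 0, isFrame_splitSection d 1, fun k => ?_, ?_⟩
  · simp [res_splitSection_zero, Matrix.diagonal_apply]
  · rw [Matrix.det_diagonal]
    exact IsMonomial.prod _ fun k => isMonomial_symm_T (d k)

variable (K) in
theorem hasRankDegree_O (d : ℤ) : HasRankDegree (O K d) 1 d :=
  hasRankDegree_of_frames (isFrame_powSection K d 0) (isFrame_powSection K d 1)
    (g := Matrix.of fun _ _ => (coordOverlap K).symm (T d))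
    (fun _ => by simp [res_powSection_zero]) (by simpa using isMonomial_symm_T d) (by simp)

theorem HasDegree.hasRankDegree (h : HasDegree E δ) (hn : HasRank E n) : HasRankDegree E n δ := by
  obtain ⟨e, d, ⟨i⟩, rfl⟩ := h
  have hE := (hasRankDegree_splitBundle K d).map_iso i.symm
  obtain rfl := hE.rank_eq hn
  exact hE

end Degree

/-! ### The Grothendieck group -/

section KGroup

variable {X : Scheme.{u}}

theorem KGroup.of_eq_add {E' E E'' : VectorBundle X} {i : E'.sheaf ⟶ E.sheaf}
    {p : E.sheaf ⟶ E''.sheaf} {w : i ≫ p = 0} (h : (ShortComplex.mk i p w).ShortExact) :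
    KGroup.of E = KGroup.of E' + KGroup.of E'' := by
  have hrel : FreeAbelianGroup.of E - FreeAbelianGroup.of E' - FreeAbelianGroup.of E'' ∈
      exactRelations X := AddSubgroup.subset_closure ⟨E', E, E'', i, p, w, h, rfl⟩
  rw [← QuotientAddGroup.eq_zero_iff, QuotientAddGroup.mk_sub, QuotientAddGroup.mk_sub, sub_sub,
    sub_eq_zero] at hrel
  exact hrel

theorem KGroup.addMonoidHom_ext {G : Type*} [AddCommGroup G] {f g : KGroup X →+ G}
    (h : ∀ E, f (KGroup.of E) = g (KGroup.of E)) : f = g :=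
  QuotientAddGroup.addMonoidHom_ext _ (FreeAbelianGroup.lift_ext _ _ h)

theorem HasRank.isZero {M : X.Modules} (h : HasRank M 0) : IsZero M := by
  have section_eq_zero (U : X.Opens) (s : Γ(M, U)) : s = 0 := eq_of_res_eq fun x hx => by
    obtain ⟨V, hxV, b, hb⟩ := hasRankAt_iff.1 (h x)
    have := (hb.basis (inf_le_right : U ⊓ V ≤ V)).repr.subsingleton
    exact ⟨U ⊓ V, inf_le_left, ⟨hx, hxV⟩, Subsingleton.elim _ _⟩
  rw [IsZero.iff_id_eq_zero]
  exact Scheme.Modules.hom_ext _ _ fun U => by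
    ext s
    exact (section_eq_zero U _).trans (section_eq_zero U _).symm

theorem KGroup.of_eq_zero {E : VectorBundle X} (h : HasRank E.sheaf 0) : KGroup.of E = 0 := by
  have hS : (ShortComplex.mk (𝟙 E.sheaf) (0 : E.sheaf ⟶ E.sheaf) comp_zero).ShortExact :=
    { exact := ShortComplex.exact_of_isZero_X₂ _ h.isZero
      mono_f := inferInstanceAs (Mono (𝟙 E.sheaf))
      epi_g := h.isZero.epi _ }
  simpa using KGroup.of_eq_add hS

end KGroup

section SubLine

open LaurentPolynomial (C T)
open scoped LaurentPolynomial

variable {K : Type u} [Field K]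

variable (K) in
/-- The line bundle `𝒪(d)` as a vector bundle. -/
def lineBundle (d : ℤ) : VectorBundle (P1 K) :=
  ⟨O K d, (hasRankDegree_O K d).hasRank.isLocallyFreeFiniteRank⟩

variable {M : (P1 K).Modules} {E : VectorBundle (P1 K)} {n : ℕ} {d δ : ℤ}

theorem exists_mono_of_frames {b₀ : Fin (n + 1) → Γ(M, chart K 0)}
    {b₁ : Fin (n + 1) → Γ(M, chart K 1)} (h₀ : IsFrame M _ b₀) (h₁ : IsFrame M _ b₁)
    (h : res M (inf_le_left : chart K 0 ⊓ chart K 1 ≤ _) (b₀ 0) =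
      (coordOverlap K).symm (T d) • res M inf_le_right (b₁ 0)) :
    ∃ φ : O K d ⟶ M, Mono φ ∧ φ.app _ (powSection K d 0) = b₀ 0 ∧
      φ.app _ (powSection K d 1) = b₁ 0 := by
  obtain ⟨φ, hφ₀, hφ₁⟩ := exists_hom_of_frames (chart_sup K) (isFrame_powSection K d 0)
    (isFrame_powSection K d 1) (fun _ => b₀ 0) (fun _ => b₁ 0)
    (g := Matrix.of fun _ _ => (coordOverlap K).symm (T d))
    (fun _ => by simp [res_powSection_zero]) (fun _ => by simp [h])
  replace hφ₀ : φ.app _ (powSection K d 0) = b₀ 0 := hφ₀ ()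
  replace hφ₁ : φ.app _ (powSection K d 1) = b₁ 0 := hφ₁ ()
  exact ⟨φ, mono_of_injective_of_sup_eq_top (chart_sup K)
    (fun _ => (isFrame_powSection K d 0).app_injective (hφ₀ ▸ h₀.sumElim_zero_succ))
    (fun _ => (isFrame_powSection K d 1).app_injective (hφ₁ ▸ h₁.sumElim_zero_succ)), hφ₀, hφ₁⟩

theorem exists_quotient_of_frames {b₀ : Fin (n + 1) → Γ(E.sheaf, chart K 0)}
    {b₁ : Fin (n + 1) → Γ(E.sheaf, chart K 1)} (h₀ : IsFrame E.sheaf _ b₀)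
    (h₁ : IsFrame E.sheaf _ b₁) (hE : HasRankDegree E.sheaf (n + 1) δ)
    (h : res E.sheaf (inf_le_left : chart K 0 ⊓ chart K 1 ≤ _) (b₀ 0) =
      (coordOverlap K).symm (T d) • res E.sheaf inf_le_right (b₁ 0)) :
    ∃ Q : VectorBundle (P1 K), HasRankDegree Q.sheaf n (δ - d) ∧
      KGroup.of E = KGroup.of (lineBundle K d) + KGroup.of Q := by
  obtain ⟨φ, hφ, hφ₀, hφ₁⟩ := exists_mono_of_frames h₀ h₁ h
  have hS : (ShortComplex.mk φ (cokernel.π φ) (cokernel.condition φ)).ShortExact :=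
    { exact := ShortComplex.exact_cokernel φ
      mono_f := hφ
      epi_g := inferInstance }
  have isTilde_cokernel (i : Fin 2) :=
    isTilde_restrict_cokernel (lineBundle K d).isLocallyFree E.isLocallyFree φ
      (isAffineOpen_chart K i).fromSpec
  have f₀ := isFrame_quotient hS (isAffineOpen_chart K 0) (E.isLocallyFree.isTilde_restrict _)
    (isTilde_cokernel 0) (isFrame_powSection K d 0) (hφ₀ ▸ h₀.sumElim_zero_succ)
  have f₁ := isFrame_quotient hS (isAffineOpen_chart K 1) (E.isLocallyFree.isTilde_restrict _)
    (isTilde_cokernel 1) (isFrame_powSection K d 1) (hφ₁ ▸ h₁.sumElim_zero_succ)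
  have hrank : HasRank (cokernel φ) n := hasRank_of_frames f₀ f₁
  obtain ⟨δ', hQ⟩ := hrank.exists_hasRankDegree
  have hadd := HasRankDegree.add hS E.isLocallyFree (hasRankDegree_O K d) hQ
  obtain rfl : δ = d + δ' := hE.degree_eq (add_comm 1 n ▸ hadd)
  let Q : VectorBundle (P1 K) := ⟨cokernel φ, hrank.isLocallyFreeFiniteRank⟩
  exact ⟨Q, by rwa [add_sub_cancel_left], KGroup.of_eq_add (E' := lineBundle K d) (E'' := Q) hS⟩

theorem exists_resFun_eq_T_mul {ι : Type*} [Finite ι] (a : ι → Γ(P1 K, chart K 0 ⊓ chart K 1)) :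
    ∃ (N : ℕ) (w : ι → Γ(P1 K, chart K 1)), ∀ i,
      resFun inf_le_right (w i) = (coordOverlap K).symm (T N) * a i := by
  obtain ⟨⟨_, N, rfl⟩, h⟩ := IsLocalization.exist_integer_multiples_of_finite
    (Submonoid.powers (Polynomial.X : Polynomial K)) fun i => coordOverlap K (a i)
  choose p hp using h
  refine ⟨N, fun i => (coord K 1).symm (p i), fun i => (coordOverlap K).injective ?_⟩
  have hpi := hp i
  rw [Algebra.smul_def, LaurentPolynomial.algebraMap_eq_toLaurent,
    LaurentPolynomial.algebraMap_eq_toLaurent, Polynomial.toLaurent_X_pow] at hpi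
  rw [coordOverlap_one, RingEquiv.apply_symm_apply, hpi, map_mul, RingEquiv.apply_symm_apply]

theorem IsFrame.exists_res_eq_T_smul {ι : Type*} [Finite ι] {b : ι → Γ(M, chart K 1)}
    (hb : IsFrame M _ b) (s : Γ(M, chart K 0 ⊓ chart K 1)) :
    ∃ (N : ℕ) (w : Γ(M, chart K 1)), res M inf_le_right w = (coordOverlap K).symm (T N) • s := by
  have := Fintype.ofFinite ι
  obtain ⟨a, rfl⟩ := (hb.restrict (inf_le_right : chart K 0 ⊓ chart K 1 ≤ _)).bijective.2 s
  obtain ⟨N, w, hw⟩ := exists_resFun_eq_T_mul a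
  exact ⟨N, ∑ i, w i • b i, by simp only [res_sum_smul, hw, Finset.smul_sum, smul_smul]⟩

theorem exists_adapted_frames (hM : HasRank M (n + 1)) :
    ∃ (d : ℤ) (b₀ : Fin (n + 1) → Γ(M, chart K 0)) (b₁ : Fin (n + 1) → Γ(M, chart K 1)),
      IsFrame M _ b₀ ∧ IsFrame M _ b₁ ∧
      res M (inf_le_left : chart K 0 ⊓ chart K 1 ≤ _) (b₀ 0) =
        (coordOverlap K).symm (T d) • res M inf_le_right (b₁ 0) := by
  obtain ⟨-, b₀, b₁, -, h₀, h₁, -⟩ := hM.exists_hasRankDegree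
  have r₀ := h₀.restrict (inf_le_left : chart K 0 ⊓ chart K 1 ≤ _)
  obtain ⟨N, w, hw⟩ := h₁.exists_res_eq_T_smul (res M inf_le_left (b₀ 0))
  have hTN : (coordOverlap K).symm (T (-N)) * (coordOverlap K).symm (T N) = 1 := by
    rw [← map_mul, ← LaurentPolynomial.T_add, neg_add_cancel, LaurentPolynomial.T_zero, map_one]
  have hb₀ : res M inf_le_left (b₀ 0) =
      (coordOverlap K).symm (T (-N)) • res M inf_le_right w := by
    rw [hw, smul_smul, hTN, one_smul]
  have hw0 : w ≠ 0 := by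
    rintro rfl
    have : Nontrivial Γ(P1 K, chart K 0 ⊓ chart K 1) := (coordOverlap K).symm.injective.nontrivial
    refine (r₀.basis le_rfl).ne_zero 0 ?_
    rw [r₀.basis_apply, res_self, hb₀, map_zero, smul_zero]
  obtain ⟨c, r, rfl⟩ := exists_basis_smul_eq (h₁.basis le_rfl) 0 hw0
  rw [res_smul, smul_smul] at hb₀
  obtain ⟨d, κ, hκ, hd⟩ := exists_isMonomial (r₀.isUnit_of_eq_smul hb₀)
  refine ⟨d, b₀, _, h₀, (h₁.of_basis c).smul
    fun _ => (Polynomial.isUnit_C.2 hκ.isUnit).map (coord K 1).symm, ?_⟩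
  rw [hb₀, res_smul, smul_smul]
  congr 1
  apply (coordOverlap K).injective
  rw [hd, map_mul, RingEquiv.apply_symm_apply, coordOverlap_one, RingEquiv.apply_symm_apply,
    Polynomial.toLaurent_C, mul_comm]

theorem exists_quotient (hE : HasRankDegree E.sheaf (n + 1) δ) :
    ∃ (d : ℤ) (Q : VectorBundle (P1 K)), HasRankDegree Q.sheaf n (δ - d) ∧
      KGroup.of E = KGroup.of (lineBundle K d) + KGroup.of Q := by
  obtain ⟨d, b₀, b₁, h₀, h₁, h⟩ := exists_adapted_frames hE.hasRank
  exact ⟨d, exists_quotient_of_frames h₀ h₁ hE h⟩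

end SubLine

section Classes

open LaurentPolynomial (T)

variable {K : Type u} [Field K] {E : VectorBundle (P1 K)} {n : ℕ} {δ : ℤ}

theorem HasRankDegree.degree_eq_zero {M : (P1 K).Modules} (h : HasRankDegree M 0 δ) : δ = 0 := by
  obtain ⟨-, -, g, -, -, -, hδ⟩ := h
  rw [Matrix.det_isEmpty] at hδ
  exact hδ.unique isMonomial_one

theorem KGroup.of_eq_lineBundle (h : HasRankDegree E.sheaf 1 δ) :
    KGroup.of E = KGroup.of (lineBundle K δ) := by
  obtain ⟨d, Q, hQ, hE⟩ := exists_quotient h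
  rw [hE, KGroup.of_eq_zero hQ.hasRank, add_zero, sub_eq_zero.1 hQ.degree_eq_zero]

theorem KGroup.of_eq_lineBundle_add_lineBundle {d : ℤ} {b₀ : Fin 2 → Γ(E.sheaf, chart K 0)}
    {b₁ : Fin 2 → Γ(E.sheaf, chart K 1)} (h₀ : IsFrame E.sheaf _ b₀) (h₁ : IsFrame E.sheaf _ b₁)
    (hE : HasRankDegree E.sheaf 2 δ)
    (h : res E.sheaf (inf_le_left : chart K 0 ⊓ chart K 1 ≤ _) (b₀ 0) =
      (coordOverlap K).symm (T d) • res E.sheaf inf_le_right (b₁ 0)) :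
    KGroup.of E = KGroup.of (lineBundle K d) + KGroup.of (lineBundle K (δ - d)) := by
  obtain ⟨Q, hQ, hEQ⟩ := exists_quotient_of_frames h₀ h₁ hE h
  rw [hEQ, KGroup.of_eq_lineBundle hQ]

/-- Both `𝒪(d + 1)` and `𝒪(d)` embed into `𝒪(d + 1) ⊕ 𝒪(d + 1)` with a line bundle as quotient,
the latter by the pair of sections `(x₀, x₁)` of `𝒪(1)`. -/
theorem lineBundle_relation (d : ℤ) :
    KGroup.of (lineBundle K d) + KGroup.of (lineBundle K (d + 2)) =
      KGroup.of (lineBundle K (d + 1)) + KGroup.of (lineBundle K (d + 1)) := by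
  have hE := hasRankDegree_splitBundle K fun _ : Fin 2 => d + 1
  let E : VectorBundle (P1 K) := ⟨_, hE.hasRank.isLocallyFreeFiniteRank⟩
  let b (i : Fin 2) (k : Fin 2) : Γ(E.sheaf, chart K i) := splitSection K (fun _ => d + 1) i k
  have hb (i : Fin 2) : IsFrame E.sheaf _ (b i) := isFrame_splitSection (fun _ => d + 1) i
  have res_b (k : Fin 2) : res E.sheaf (inf_le_left : chart K 0 ⊓ chart K 1 ≤ _) (b 0 k) =
      (coordOverlap K).symm (T (d + 1)) • res E.sheaf inf_le_right (b 1 k) :=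
    res_splitSection_zero (fun _ => d + 1) k
  let s := (coord K 0).symm Polynomial.X
  let t := (coord K 1).symm Polynomial.X
  have res_s : resFun (inf_le_left : chart K 0 ⊓ chart K 1 ≤ _) s =
      (coordOverlap K).symm (T (-1)) :=
    (coordOverlap K).injective (by simp [s, coordOverlap_zero])
  have res_t : resFun (inf_le_right : chart K 0 ⊓ chart K 1 ≤ _) t =
      (coordOverlap K).symm (T 1) :=
    (coordOverlap K).injective (by simp [t, coordOverlap_one])
  have hc₀ : IsFrame E.sheaf _ ![b 0 0 + s • b 0 1, b 0 1] :=
    (hb 0).of_isUnit_det (A := !![1, 0; s, 1]) (fun k => by fin_cases k <;> simp) (by simp)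
  have hc₁ : IsFrame E.sheaf _ ![t • b 1 0 + b 1 1, b 1 0] :=
    (hb 1).of_isUnit_det (A := !![t, 1; 1, 0]) (fun k => by fin_cases k <;> simp) (by simp)
  have T_mul (m n : ℤ) : (coordOverlap K).symm (T m) * (coordOverlap K).symm (T n) =
      (coordOverlap K).symm (T (m + n)) := by
    rw [← map_mul, ← LaurentPolynomial.T_add]
  have hd := KGroup.of_eq_lineBundle_add_lineBundle (d := d) hc₀ hc₁ hE (by
    simp [res_smul, res_b, res_s, res_t, smul_smul, T_mul])
  have hd' := KGroup.of_eq_lineBundle_add_lineBundle (hb 0) (hb 1) hE (res_b 0)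
  rw [Fin.sum_const, two_nsmul] at hd hd'
  rw [add_sub_cancel_right] at hd'
  rw [← hd', hd]
  congr 3
  ring

theorem eq_add_zsmul_of_add_eq_add {G : Type*} [AddCommGroup G] {f : ℤ → G}
    (h : ∀ d, f d + f (d + 2) = f (d + 1) + f (d + 1)) (d : ℤ) :
    f d = f 0 + d • (f 1 - f 0) := by
  suffices f d = f 0 + d • (f 1 - f 0) ∧ f (d + 1) = f 0 + (d + 1) • (f 1 - f 0) from this.1
  induction d using Int.induction_on with
  | zero => simp
  | succ d ih =>
    refine ⟨ih.2, ?_⟩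
    rw [add_assoc, one_add_one_eq_two, ← add_right_inj, h, ih.1, ih.2]
    module
  | pred d ih =>
    rw [sub_add_cancel]
    refine ⟨?_, ih.1⟩
    have hd := h (-d - 1)
    rw [sub_add_cancel, show (-d - 1 + 2 : ℤ) = -d + 1 by ring, ih.1, ih.2] at hd
    rw [eq_sub_iff_add_eq.2 hd]
    module

theorem KGroup.of_eq (h : HasRankDegree E.sheaf n δ) :
    KGroup.of E = n • KGroup.of (lineBundle K 0) +
      δ • (KGroup.of (lineBundle K 1) - KGroup.of (lineBundle K 0)) := by
  induction n generalizing E δ with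
  | zero => simp [KGroup.of_eq_zero h.hasRank, h.degree_eq_zero]
  | succ n ih =>
    obtain ⟨d, Q, hQ, hE⟩ := exists_quotient h
    rw [hE, ih hQ, eq_add_zsmul_of_add_eq_add lineBundle_relation d]
    module

theorem KGroup.addMonoidHom_ext_lineBundle {G : Type*} [AddCommGroup G]
    {f g : KGroup (P1 K) →+ G}
    (h₀ : f (KGroup.of (lineBundle K 0)) = g (KGroup.of (lineBundle K 0)))
    (h₁ : f (KGroup.of (lineBundle K 1)) = g (KGroup.of (lineBundle K 1))) : f = g := by
  refine KGroup.addMonoidHom_ext fun E => ?_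
  obtain ⟨n, δ, h⟩ := exists_hasRankDegree E.isLocallyFree
  simp only [KGroup.of_eq h, map_add, map_nsmul, map_zsmul, map_sub, h₀, h₁]

/-- The degree and the rank of a vector bundle on the projective line. -/
def degreeRank (E : VectorBundle (P1 K)) : ℤ × ℤ :=
  ((exists_hasRankDegree E.isLocallyFree).choose_spec.choose,
    (exists_hasRankDegree E.isLocallyFree).choose)

theorem HasRankDegree.degreeRank_eq (h : HasRankDegree E.sheaf n δ) :
    degreeRank E = (δ, (n : ℤ)) := by
  have unique {n' : ℕ} {δ' : ℤ} (h' : HasRankDegree E.sheaf n' δ') :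
      (δ', (n' : ℤ)) = (δ, (n : ℤ)) := by
    obtain rfl := h'.rank_eq h.hasRank
    rw [h'.degree_eq h]
  exact unique (exists_hasRankDegree E.isLocallyFree).choose_spec.choose_spec

variable (K) in
/-- The degree and the rank as a homomorphism on the Grothendieck group. -/
def degreeRankHom : KGroup (P1 K) →+ ℤ × ℤ :=
  QuotientAddGroup.lift _ (FreeAbelianGroup.lift degreeRank) <| by
    rw [exactRelations, AddSubgroup.closure_le]
    rintro _ ⟨E', E, E'', i, p, w, hS, rfl⟩
    obtain ⟨n', δ', h'⟩ := exists_hasRankDegree E'.isLocallyFree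
    obtain ⟨n'', δ'', h''⟩ := exists_hasRankDegree E''.isLocallyFree
    have h : HasRankDegree E.sheaf _ _ := HasRankDegree.add hS E.isLocallyFree h' h''
    simp [h.degreeRank_eq, h'.degreeRank_eq, h''.degreeRank_eq]

theorem degreeRankHom_of (h : HasRankDegree E.sheaf n δ) :
    degreeRankHom K (KGroup.of E) = (δ, (n : ℤ)) :=
  (FreeAbelianGroup.lift_apply_of degreeRank E).trans h.degreeRank_eq

theorem degreeRankHom_lineBundle (d : ℤ) :
    degreeRankHom K (KGroup.of (lineBundle K d)) = (d, 1) :=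
  degreeRankHom_of (hasRankDegree_O K d)

variable (K) in
/-- The identification of the Grothendieck group of the projective line with `ℤ × ℤ` by the degree
and the rank. -/
def degreeRankEquiv : KGroup (P1 K) ≃+ ℤ × ℤ :=
  (degreeRankHom K).toAddEquiv
    ((zmultiplesHom _ (KGroup.of (lineBundle K 1) - KGroup.of (lineBundle K 0))).coprod
      (zmultiplesHom _ (KGroup.of (lineBundle K 0))))
    (KGroup.addMonoidHom_ext_lineBundle (by simp [degreeRankHom_lineBundle])
      (by simp [degreeRankHom_lineBundle]))
    (AddMonoidHom.ext fun z => by simp [degreeRankHom_lineBundle])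

theorem HasDegree.degreeRankHom_of (h : HasDegree E.sheaf δ) (hn : HasRank E.sheaf n) :
    degreeRankHom K (KGroup.of E) = (δ, (n : ℤ)) :=
  KTheoryP1.degreeRankHom_of (h.hasRankDegree hn)

theorem HasRank.degreeRankHom_of_snd (h : HasRank E.sheaf n) :
    (degreeRankHom K (KGroup.of E)).2 = n := by
  obtain ⟨δ, hδ⟩ := h.exists_hasRankDegree
  rw [degreeRankHom_of hδ]

variable (K) in
theorem hasDegree_O (d : ℤ) : HasDegree (O K d) d :=
  ⟨1, fun _ => d, ⟨(biproductUniqueIso fun _ : Fin 1 => O K d).symm⟩, by simp⟩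

end Classes

end KTheoryP1

end

open KTheoryP1 in
theorem corollary4p2_general (K : Type u) [Field K] :
    (∀ (e : ℕ) (d : Fin e → ℤ), HasRank (splitBundle K d) e) ∧
    ∃! φ : KGroup (P1 K) ≃+ ℤ × ℤ,
      (∀ (E : VectorBundle (P1 K)) (δ : ℤ) (r : ℕ),
        HasDegree E.sheaf δ → HasRank E.sheaf r → φ (KGroup.of E) = (δ, (r : ℤ))) ∧
      (∀ (E : VectorBundle (P1 K)) (r : ℕ),
        HasRank E.sheaf r → (φ (KGroup.of E)).2 = (r : ℤ)) := by
  refine ⟨fun e d => (hasRankDegree_splitBundle K d).hasRank, degreeRankEquiv K,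
    ⟨fun E δ r hδ hr => hδ.degreeRankHom_of hr, fun E r hr => hr.degreeRankHom_of_snd⟩,
    fun φ ⟨hφ, _⟩ => ?_⟩
  have hφ_lineBundle (d : ℤ) : φ (KGroup.of (lineBundle K d)) =
      degreeRankEquiv K (KGroup.of (lineBundle K d)) :=
    (hφ _ d 1 (hasDegree_O K d) (hasRankDegree_O K d).hasRank).trans
      (degreeRankHom_lineBundle d).symm
  exact AddEquiv.toAddMonoidHom_injective
    (KGroup.addMonoidHom_ext_lineBundle (hφ_lineBundle 0) (hφ_lineBundle 1))

theorem corollary4p2 (K : Type u) [Field K] [IsAlgClosed K] [CharZero K] :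
    (∀ (e : ℕ) (d : Fin e → ℤ), KTheoryP1.HasRank (KTheoryP1.splitBundle K d) e) ∧
    ∃! φ : KTheoryP1.KGroup (KTheoryP1.P1 K) ≃+ ℤ × ℤ,
      (∀ (E : KTheoryP1.VectorBundle (KTheoryP1.P1 K)) (δ : ℤ) (r : ℕ),
        KTheoryP1.HasDegree E.sheaf δ → KTheoryP1.HasRank E.sheaf r →
          φ (KTheoryP1.KGroup.of E) = (δ, (r : ℤ))) ∧
      (∀ (E : KTheoryP1.VectorBundle (KTheoryP1.P1 K)) (r : ℕ),
        KTheoryP1.HasRank E.sheaf r → (φ (KTheoryP1.KGroup.of E)).2 = (r : ℤ)) :=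
  corollary4p2_general K
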